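/- Let $n\ge 1$, write $x=(x_1,\dots,x_n)$, $x_0=t$, $\rho=|\psi|$, and sum over repeated indices $a,b\in\{1,\dots,n\}$; subscripts of functions denote partial derivatives. Let $\mathcal D\subseteq\mathbb R_t\times\mathbb R^n_x\times(0,\infty)_\rho$ be a nonempty open connected set all of whose nonempty sections $t=\mathrm{const}$ are connected, and let $\mathcal T\subseteq\mathbb R$ be its projection to the $t$-axis (an open interval). Let $S\colon\mathcal D\to\mathbb C$ be smooth with $S_\rho\ne 0$, in the sense that $S_\rho$ does not vanish identically on any nonempty open subset of $\mathcal D$. Consider the nonlinear Schrödinger equation $$\mathcal L_S\colon\quad i\psi_t+\psi_{aa}+S(t,x,\rho)\psi=0 .$$ Its maximal Lie invariance algebra $\mathfrak g_S$ is the set of all vector fields $Q=\tau\partial_t+\xi^a\partial_a+\eta\partial_\psi+\eta^*\partial_{\psi^*}$ with smooth real-valued components $\tau,\xi^a$ and smooth complex-valued component $\eta$ (with complex conjugate $\eta^*$), functions of $(t,x,\psi,\psi^*)$ with $(t,x,|\psi|)\in\mathcal D$, that satisfy the infinitesimal invariance criterion $Q_{(2)}\bigl(i\psi_t+\psi_{aa}+S(t,x,\rho)\psi\bigr)\big|_{\mathcal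 L_S}=0$, where $Q_{(2)}$ is the second prolongation of $Q$ to the jet space and the restriction is to the manifold defined by $\mathcal L_S$ in the second-order jet space. Then $\mathfrak g_S$ consists exactly of the vector fields of the form $$Q=D(\tau)-\sum_{a<b}\kappa_{ab}J_{ab}+P(\chi)+\sigma M+\zeta I,$$ where $$D(\tau)=\tau\partial_t+\tfrac12\tau_tx_a\partial_a+\tfrac18\tau_{tt}x_ax_aM,\quad J_{ab}=x_a\partial_b-x_b\partial_a,\quad P(\chi)=\chi^a\partial_a+\tfrac12\chi^a_tx_aM,$$ $$M=i\psi\partial_\psi-i\psi^*\partial_{\psi^*},\quad I=\psi\partial_\psi+\psi^*\partial_{\psi^*},$$ the parameters $\tau,\chi^1,\dots,\chi^n,\sigma,\zeta$ are smooth real-valued functions of $t\in\mathcal T$, and $(\kappa_{ab})$ is a constant real skew-symmetric $n\times n$ matrix, such that together they satisfy the classifying condition $$\tau S_t+\Bigl(\tfrac12\tau_tx_a+\kappa_{ab}x_b+\chi^a\Bigr)S_a+\zeta\rho S_\rho+\tau_tS=\tfrac18\tau_{ttt}x_ax_a+\tfrac12\chi^a_{tt}x_a+\sigma_t-i\zeta_t-i\tfrac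 n4\tau_{tt}$$ at all points $(t,x,\rho)\in\mathcal D$. -/

import Mathlib

open scoped ContDiff

noncomputable section

namespace NLSym

/-- Independent variables `(x_0, x_1, …, x_n)`, where `x_0 = t` is the time. -/
abbrev Base (n : ℕ) := Fin (n + 1) → ℝ

/-- First-order jets `(x, ψ, ψ_μ)`. The conjugate coordinates `ψ*`, `ψ*_μ` are determined by
`ψ`, `ψ_μ`, and all differentiations below are over `ℝ`, so that they act on both. -/
abbrev Jet1 (n : ℕ) := Base n × ℂ × (Fin (n + 1) → ℂ)

/-- Second-order jets `(x, ψ, ψ_μ, ψ_{μν})`; genuine jets have symmetric `ψ_{μν}`. -/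
abbrev Jet2 (n : ℕ) :=
  Base n × ℂ × (Fin (n + 1) → ℂ) × (Fin (n + 1) → Fin (n + 1) → ℂ)

/-- Third-order jets `(x, ψ, ψ_μ, ψ_{μν}, ψ_{μνκ})`; see `Jet3.IsSymm`. -/
abbrev Jet3 (n : ℕ) :=
  Base n × ℂ × (Fin (n + 1) → ℂ) × (Fin (n + 1) → Fin (n + 1) → ℂ) ×
    (Fin (n + 1) → Fin (n + 1) → Fin (n + 1) → ℂ)

variable {n : ℕ}

/-- The derivatives are symmetric in their indices. -/
def Jet3.IsSymm (j : Jet3 n) : Prop :=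
  (∀ μ ν, j.2.2.2.1 μ ν = j.2.2.2.1 ν μ) ∧
  (∀ μ ν l, j.2.2.2.2 μ ν l = j.2.2.2.2 ν μ l) ∧
  (∀ μ ν l, j.2.2.2.2 μ ν l = j.2.2.2.2 μ l ν)

/-- The projection from third-order to second-order jets. -/
def Jet3.toJet2 (j : Jet3 n) : Jet2 n := (j.1, j.2.1, j.2.2.1, j.2.2.2.1)

/-- The total derivative `D_μ F` of a function of first-order jets. -/
def totalDeriv1 (μ : Fin (n + 1)) (F : Jet1 n → ℂ) : Jet2 n → ℂ := fun j =>
  fderiv ℝ F (j.1, j.2.1, j.2.2.1) (Pi.single μ 1, j.2.2.1 μ, j.2.2.2 μ)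

/-- The total derivative `D_μ F` of a function of second-order jets. -/
def totalDeriv2 (μ : Fin (n + 1)) (F : Jet2 n → ℂ) : Jet3 n → ℂ := fun j =>
  fderiv ℝ F j.toJet2 (Pi.single μ 1, j.2.2.1 μ, j.2.2.2.1 μ, j.2.2.2.2 μ)

/-- A vector field `τ ∂_t + ξ^a ∂_a + η ∂_ψ + η* ∂_{ψ*}` on the space of `(t, x, ψ)`, given by its
components: `(Q z).1 0 = τ`, `(Q z).1 a.succ = ξ^a`, `(Q z).2 = η`. -/
abbrev VField (n : ℕ) := Base n × ℂ → Base n × ℂ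

/-- The characteristic `η - τ ψ_t - ξ^a ψ_a` of a vector field. -/
def characteristic (Q : VField n) : Jet1 n → ℂ := fun j =>
  (Q (j.1, j.2.1)).2 - ∑ μ, ((Q (j.1, j.2.1)).1 μ : ℂ) * j.2.2 μ

/-- The component `η^μ` of the prolongation of `Q`. -/
def prolong1 (Q : VField n) (μ : Fin (n + 1)) : Jet2 n → ℂ := fun j =>
  totalDeriv1 μ (characteristic Q) j + ∑ ν, ((Q (j.1, j.2.1)).1 ν : ℂ) * j.2.2.2 μ ν

/-- The component `η^{μν}` of the prolongation of `Q`. It is written on third-order jets, although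
it does not depend on the third derivatives. -/
def prolong2 (Q : VField n) (μ ν : Fin (n + 1)) : Jet3 n → ℂ := fun j =>
  totalDeriv2 μ (totalDeriv1 ν (characteristic Q)) j +
    ∑ l, ((Q (j.1, j.2.1)).1 l : ℂ) * j.2.2.2.2 μ ν l

/-- The second prolongation `Q_(2)`: a tangent vector to the space of second-order jets. -/
def prolong (Q : VField n) (j : Jet3 n) : Jet2 n :=
  ((Q (j.1, j.2.1)).1, (Q (j.1, j.2.1)).2,
    fun μ => prolong1 Q μ j.toJet2, fun μ ν => prolong2 Q μ ν j)

/-- The left-hand side `i ψ_t + ψ_aa + S(t, x, |ψ|) ψ` of the equation, on second-order jets. -/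
def eqnLHS (S : Base n × ℝ → ℂ) : Jet2 n → ℂ := fun j =>
  Complex.I * j.2.2.1 0 + ∑ a : Fin n, j.2.2.2 a.succ a.succ + S (j.1, ‖j.2.1‖) * j.2.1

/-- The partial derivative `S_μ`; `S_0 = S_t`. -/
def dBase (S : Base n × ℝ → ℂ) (μ : Fin (n + 1)) (p : Base n × ℝ) : ℂ :=
  fderiv ℝ S p (Pi.single μ 1, 0)

/-- The partial derivative `S_ρ`. -/
def dRho (S : Base n × ℝ → ℂ) (p : Base n × ℝ) : ℂ := fderiv ℝ S p (0, 1)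

/-- Admissible domains for the arguments `(t, x, ρ)` of `S`: open connected sets in the region
`ρ > 0` all of whose sections `t = const` are connected or empty. -/
structure IsAdmissibleDomain (D : Set (Base n × ℝ)) : Prop where
  isOpen : IsOpen D
  isConnected : IsConnected D
  slice_isPreconnected : ∀ t : ℝ, IsPreconnected {p ∈ D | p.1 0 = t}
  rho_pos : ∀ p ∈ D, 0 < p.2

/-- `S` belongs to the class on the domain `D`: it is smooth, and `S_ρ ≠ 0` in the sense that `S_ρ`
vanishes identically on no nonempty open subset of `D`. -/
structure IsClassS (D : Set (Base n × ℝ)) (S : Base n × ℝ → ℂ) : Prop where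
  smooth : ContDiffOn ℝ ∞ S D
  dRho_ne_zero : D ⊆ closure {p ∈ D | dRho S p ≠ 0}

/-- The set of `(t, x, ψ)` with `(t, x, |ψ|) ∈ D`. -/
def pointSpace (D : Set (Base n × ℝ)) : Set (Base n × ℂ) := {z | (z.1, ‖z.2‖) ∈ D}

/-- The interval of the values of `t` on `D`. -/
def timeSet (D : Set (Base n × ℝ)) : Set ℝ := (fun p => p.1 0) '' D

/-- The maximal Lie invariance algebra of the equation `i ψ_t + ψ_aa + S(t, x, |ψ|) ψ = 0`: the
smooth vector fields whose second prolongation annihilates the left-hand side of the equation on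
the manifold that the equation defines in the jet space. -/
def maximalLieInvarianceAlgebra (D : Set (Base n × ℝ)) (S : Base n × ℝ → ℂ) : Set (VField n) :=
  {Q | ContDiffOn ℝ ∞ Q (pointSpace D) ∧
    ∀ j : Jet3 n, j.IsSymm → (j.1, j.2.1) ∈ pointSpace D → eqnLHS S j.toJet2 = 0 →
      fderiv ℝ (eqnLHS S) j.toJet2 (prolong Q j) = 0}

/-- `M = i ψ ∂_ψ - i ψ* ∂_{ψ*}`. -/
def fieldM : VField n := fun z => (0, Complex.I * z.2)

/-- `I = ψ ∂_ψ + ψ* ∂_{ψ*}`. -/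
def fieldI : VField n := fun z => (0, z.2)

/-- `J_ab = x_a ∂_b - x_b ∂_a`. -/
def fieldJ (a b : Fin n) : VField n := fun z =>
  (Pi.single b.succ (z.1 a.succ) - Pi.single a.succ (z.1 b.succ), 0)

/-- `D(τ) = τ ∂_t + (1/2) τ_t x_a ∂_a + (1/8) τ_tt x_a x_a M`. -/
def fieldD (τ : ℝ → ℝ) : VField n := fun z =>
  (Fin.cons (τ (z.1 0)) (fun a : Fin n => 1 / 2 * deriv τ (z.1 0) * z.1 a.succ), 0) +
    (1 / 8 * iteratedDeriv 2 τ (z.1 0) * ∑ a : Fin n, z.1 a.succ * z.1 a.succ) • fieldM z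

/-- `P(χ) = χ^a ∂_a + (1/2) χ^a_t x_a M`. -/
def fieldP (χ : Fin n → ℝ → ℝ) : VField n := fun z =>
  (Fin.cons 0 (fun a : Fin n => χ a (z.1 0)), 0) +
    (1 / 2 * ∑ a : Fin n, deriv (χ a) (z.1 0) * z.1 a.succ) • fieldM z

/-- `D(τ) - ∑_{a<b} κ_ab J_ab + P(χ) + σ M + ζ I`. -/
def generalField (τ : ℝ → ℝ) (κ : Matrix (Fin n) (Fin n) ℝ) (χ : Fin n → ℝ → ℝ)
    (σ ζ : ℝ → ℝ) : VField n := fun z =>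
  fieldD τ z - ∑ a : Fin n, ∑ b ∈ Finset.Ioi a, κ a b • fieldJ a b z + fieldP χ z
    + σ (z.1 0) • fieldM z + ζ (z.1 0) • fieldI z

/-- The classifying condition at the point `p = (t, x, ρ)`. -/
def ClassifyingCondition (S : Base n × ℝ → ℂ) (τ : ℝ → ℝ) (κ : Matrix (Fin n) (Fin n) ℝ)
    (χ : Fin n → ℝ → ℝ) (σ ζ : ℝ → ℝ) (p : Base n × ℝ) : Prop :=
  let t : ℝ := p.1 0
  let x : Fin n → ℝ := fun a => p.1 a.succ
  let ρ : ℝ := p.2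
  (τ t : ℂ) * dBase S 0 p
      + ∑ a : Fin n,
        ((1 / 2 * deriv τ t * x a + ∑ b : Fin n, κ a b * x b + χ a t : ℝ) : ℂ) * dBase S a.succ p
      + (ζ t : ℂ) * (ρ : ℂ) * dRho S p + ((deriv τ t : ℝ) : ℂ) * S p
    = ((1 / 8 * iteratedDeriv 3 τ t * ∑ a : Fin n, x a * x a
          + 1 / 2 * ∑ a : Fin n, iteratedDeriv 2 (χ a) t * x a + deriv σ t : ℝ) : ℂ)
      - Complex.I * ((deriv ζ t : ℝ) : ℂ) - Complex.I * ((n : ℂ) / 4) * ((iteratedDeriv 2 τ t : ℝ) : ℂ)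

end NLSym

end

/-!
On the manifold defined by the equation, all jet coordinates except `ψ_t` are unconstrained, and the
infinitesimal invariance criterion is polynomial in them. The off-diagonal second derivatives of `ψ`
force `τ = τ(t)` and the off-diagonal Killing equations for `ξ`; the diagonal ones force `ξ` to be
independent of `ψ`, `∂_a ξ^a = τ_t / 2` (no sum), and `η` to be holomorphic in `ψ`. The first and
second powers of `ψ_a` then make `η = η¹(t, x) ψ + η⁰(t, x)` with `2 ∂_a η¹ = i ξ^a_t`.

What remains is one equation of order zero, a quadratic polynomial in the phase of `ψ`. Its leading
coefficient is a multiple of `S_ρ` times the conjugate of `η⁰`, so `η⁰` vanishes on a dense set,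
hence everywhere, and its linear coefficient is the classifying condition.

Since the conformal factor `τ_t` depends on `t` only, the second `x`-derivatives of `ξ` vanish, and
`∂_a ∂_b η¹` being symmetric makes the rotation part `κ` independent of `t`. The sections
`t = const` are connected, so each constant of integration is a function of `t` alone.
-/

noncomputable section

namespace NLSym

section DirectionalDerivative

variable {E F G : Type*} [NormedAddCommGroup E] [NormedSpace ℝ E] [NormedAddCommGroup F]
  [NormedSpace ℝ F] [NormedAddCommGroup G] [NormedSpace ℝ G]

/-- The derivative of `f` in the fixed direction `v`, as an operator on functions. -/
def dirDeriv (v : E) (f : E → F) : E → F := fun z => fderiv ℝ f z v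

theorem dirDeriv_zero_left (f : E → F) (z : E) : dirDeriv 0 f z = 0 :=
  map_zero (fderiv ℝ f z)

theorem dirDeriv_add_left (u v : E) (f : E → F) (z : E) :
    dirDeriv (u + v) f z = dirDeriv u f z + dirDeriv v f z :=
  map_add (fderiv ℝ f z) u v

theorem dirDeriv_smul_left (c : ℝ) (v : E) (f : E → F) (z : E) :
    dirDeriv (c • v) f z = c • dirDeriv v f z :=
  map_smul (fderiv ℝ f z) c v

theorem dirDeriv_sum_left {ι : Type*} (s : Finset ι) (v : ι → E) (f : E → F) (z : E) :
    dirDeriv (∑ i ∈ s, v i) f z = ∑ i ∈ s, dirDeriv (v i) f z :=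
  map_sum (fderiv ℝ f z) v s

section Rules

variable {z : E} (v : E)

theorem dirDeriv_add {f g : E → F} (hf : DifferentiableAt ℝ f z) (hg : DifferentiableAt ℝ g z) :
    dirDeriv v (fun y => f y + g y) z = dirDeriv v f z + dirDeriv v g z := by
  simp only [dirDeriv, fderiv_fun_add hf hg, _root_.add_apply]

theorem dirDeriv_sub {f g : E → F} (hf : DifferentiableAt ℝ f z) (hg : DifferentiableAt ℝ g z) :
    dirDeriv v (fun y => f y - g y) z = dirDeriv v f z - dirDeriv v g z := by
  simp only [dirDeriv, fderiv_fun_sub hf hg, _root_.sub_apply]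

theorem dirDeriv_sum {ι : Type*} (s : Finset ι) {f : ι → E → F}
    (hf : ∀ i ∈ s, DifferentiableAt ℝ (f i) z) :
    dirDeriv v (fun y => ∑ i ∈ s, f i y) z = ∑ i ∈ s, dirDeriv v (f i) z := by
  simp only [dirDeriv, fderiv_fun_sum hf, _root_.sum_apply]

theorem dirDeriv_mul {A : Type*} [NormedCommRing A] [NormedAlgebra ℝ A] {f g : E → A}
    (hf : DifferentiableAt ℝ f z) (hg : DifferentiableAt ℝ g z) :
    dirDeriv v (fun y => f y * g y) z = dirDeriv v f z * g z + f z * dirDeriv v g z := by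
  simp only [dirDeriv, fderiv_fun_mul hf hg, _root_.add_apply, _root_.smul_apply, smul_eq_mul]
  ring

theorem dirDeriv_clm_comp (L : F →L[ℝ] G) {f : E → F} (hf : DifferentiableAt ℝ f z) :
    dirDeriv v (fun y => L (f y)) z = L (dirDeriv v f z) :=
  DFunLike.congr_fun (L.hasFDerivAt.comp z hf.hasFDerivAt).fderiv v

theorem dirDeriv_ofReal {f : E → ℝ} (hf : DifferentiableAt ℝ f z) :
    dirDeriv v (fun y => (f y : ℂ)) z = ((dirDeriv v f z : ℝ) : ℂ) :=
  dirDeriv_clm_comp v Complex.ofRealCLM hf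

theorem dirDeriv_clm (L : E →L[ℝ] F) : dirDeriv v L z = L v := by
  rw [dirDeriv, L.fderiv]

theorem dirDeriv_comp_clm {f : F → G} (L : E →L[ℝ] F) (hf : DifferentiableAt ℝ f (L z)) :
    dirDeriv v (fun y => f (L y)) z = dirDeriv (L v) f (L z) :=
  DFunLike.congr_fun (hf.hasFDerivAt.comp z L.hasFDerivAt).fderiv v

section SubSum

variable {ι : Type*} [Fintype ι] {f : E → ℂ} {g : ι → E → ℝ} (hf : DifferentiableAt ℝ f z)
  (hg : ∀ i, DifferentiableAt ℝ (g i) z) (L : ι → E →L[ℝ] ℂ)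
include hf hg

theorem differentiableAt_sub_sum_ofReal_mul :
    DifferentiableAt ℝ (fun y => f y - ∑ i, (g i y : ℂ) * L i y) z :=
  hf.sub (DifferentiableAt.fun_sum fun i _ =>
    (Complex.ofRealCLM.differentiableAt.comp z (hg i)).mul (L i).differentiableAt)

theorem dirDeriv_sub_sum_ofReal_mul :
    dirDeriv v (fun y => f y - ∑ i, (g i y : ℂ) * L i y) z =
      dirDeriv v f z - ∑ i, (((dirDeriv v (g i) z : ℝ) : ℂ) * L i z + (g i z : ℂ) * L i v) := by
  have hgC (i) : DifferentiableAt ℝ (fun y => (g i y : ℂ)) z :=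
    Complex.ofRealCLM.differentiableAt.comp z (hg i)
  have hprod (i) : DifferentiableAt ℝ (fun y => (g i y : ℂ) * L i y) z :=
    (hgC i).mul (L i).differentiableAt
  rw [dirDeriv_sub v hf (DifferentiableAt.fun_sum fun i _ => hprod i),
    dirDeriv_sum v _ fun i _ => hprod i]
  congr 1
  refine Finset.sum_congr rfl fun i _ => ?_
  rw [dirDeriv_mul v (hgC i) (L i).differentiableAt, dirDeriv_ofReal v (hg i), dirDeriv_clm]

end SubSum

end Rules

variable {U : Set E} {f : E → F} {z : E}

theorem differentiableAt_of_contDiffOn (hU : IsOpen U) (hf : ContDiffOn ℝ ∞ f U) (hz : z ∈ U) :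
    DifferentiableAt ℝ f z :=
  (hf.contDiffAt (hU.mem_nhds hz)).differentiableAt (by simp)

theorem contDiffOn_dirDeriv (hU : IsOpen U) (hf : ContDiffOn ℝ ∞ f U) (v : E) :
    ContDiffOn ℝ ∞ (dirDeriv v f) U :=
  (hf.fderiv_of_isOpen hU (m := ∞) (by simp)).clm_apply contDiffOn_const

theorem differentiableAt_fderiv (hU : IsOpen U) (hf : ContDiffOn ℝ ∞ f U) (hz : z ∈ U) :
    DifferentiableAt ℝ (fderiv ℝ f) z :=
  differentiableAt_of_contDiffOn hU (hf.fderiv_of_isOpen hU (m := ∞) (by simp)) hz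

theorem dirDeriv_congr (hU : IsOpen U) {g : E → F} (h : Set.EqOn f g U) (v : E) :
    Set.EqOn (dirDeriv v f) (dirDeriv v g) U := fun _ hz => by
  rw [dirDeriv, dirDeriv, (h.eventuallyEq_of_mem (hU.mem_nhds hz)).fderiv_eq]

theorem dirDeriv_eq_zero_of_eqOn_const (hU : IsOpen U) {c : F} (h : ∀ z ∈ U, f z = c)
    (hz : z ∈ U) (v : E) : dirDeriv v f z = 0 := by
  rw [dirDeriv_congr hU (g := fun _ => c) h v hz, dirDeriv, fderiv_fun_const]
  rfl

theorem dirDeriv_dirDeriv (hU : IsOpen U) (hf : ContDiffOn ℝ ∞ f U) (hz : z ∈ U) (u v : E) :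
    dirDeriv u (dirDeriv v f) z = fderiv ℝ (fderiv ℝ f) z u v := by
  have h := (differentiableAt_fderiv hU hf hz).hasFDerivAt.clm_apply (hasFDerivAt_const v z)
  rw [dirDeriv, show dirDeriv v f = fun z => fderiv ℝ f z v from rfl, h.fderiv]
  simp

theorem dirDeriv_comm (hU : IsOpen U) (hf : ContDiffOn ℝ ∞ f U) (hz : z ∈ U) (u v : E) :
    dirDeriv u (dirDeriv v f) z = dirDeriv v (dirDeriv u f) z := by
  rw [dirDeriv_dirDeriv hU hf hz, dirDeriv_dirDeriv hU hf hz]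
  exact ((hf.contDiffAt (hU.mem_nhds hz)).isSymmSndFDerivAt (by simpa using ENat.LEInfty.out)).eq
    u v

theorem dirDeriv_dirDeriv_add_self (hU : IsOpen U) (hf : ContDiffOn ℝ ∞ f U) (hz : z ∈ U)
    (u v : E) :
    dirDeriv (u + v) (dirDeriv (u + v) f) z =
      dirDeriv u (dirDeriv u f) z + (2 : ℝ) • dirDeriv u (dirDeriv v f) z +
        dirDeriv v (dirDeriv v f) z := by
  have hcomm := dirDeriv_comm hU hf hz v u
  simp only [dirDeriv_dirDeriv hU hf hz, map_add, _root_.add_apply] at hcomm ⊢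
  rw [hcomm, two_smul]
  abel

/-- The direction of differentiation may depend on the point: this is what produces the terms with
the next-order jet coordinates in total derivatives. -/
theorem dirDeriv_fderiv_apply (hU : IsOpen U) (hf : ContDiffOn ℝ ∞ f U) (π c : G →L[ℝ] E) (e : E)
    {y : G} (hy : π y ∈ U) (u : G) :
    dirDeriv u (fun y => fderiv ℝ f (π y) (e + c y)) y =
      dirDeriv (π u) (dirDeriv (e + c y) f) (π y) + dirDeriv (c u) f (π y) := by
  have h : HasFDerivAt (fun y => fderiv ℝ f (π y) (e + c y)) _ y :=
    ((differentiableAt_fderiv hU hf hy).hasFDerivAt.comp y π.hasFDerivAt).clm_apply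
      (c.hasFDerivAt.const_add e)
  rw [dirDeriv_dirDeriv hU hf hy, dirDeriv, h.fderiv, add_comm]
  rfl

theorem eq_of_map_eq_of_dirDeriv_eq_zero (hU : IsOpen U) (l : E →L[ℝ] G)
    (hf : DifferentiableOn ℝ f U) (h : ∀ z ∈ U, ∀ v, l v = 0 → dirDeriv v f z = 0) {t : G}
    (hc : IsPreconnected {z ∈ U | l z = t}) {w : E} (hz : z ∈ U) (hw : w ∈ U) (hzt : l z = t)
    (hwt : l w = t) : f z = f w := by
  let shift : l.ker → E := fun v => z + v
  have hshift : Topology.IsInducing shift :=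
    (Homeomorph.addLeft z).isInducing.comp Topology.IsInducing.subtypeVal
  have hfibre : shift '' (shift ⁻¹' U) = {y ∈ U | l y = t} := by
    ext y
    refine ⟨?_, fun ⟨hy, hyt⟩ => ⟨⟨y - z, by simp [hzt, hyt]⟩, ?_⟩⟩
    · rintro ⟨v, hv, rfl⟩
      exact ⟨hv, by simp [shift, hzt]⟩
    · simpa [shift] using hy
  rw [← hfibre, hshift.isPreconnected_image] at hc
  have hderiv (v : l.ker) (hv : shift v ∈ U) :
      HasFDerivAt (fun v => f (shift v)) ((fderiv ℝ f (shift v)).comp l.ker.subtypeL) v :=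
    (hf.differentiableAt (hU.mem_nhds hv)).hasFDerivAt.comp v
      (l.ker.subtypeL.hasFDerivAt.const_add z)
  have hconst := (hU.preimage hshift.continuous).is_const_of_fderiv_eq_zero hc
    (fun v hv => (hderiv v hv).differentiableAt.differentiableWithinAt)
    (fun v hv => by
      rw [(hderiv v hv).fderiv]
      ext u
      exact h _ hv u u.2)
    (x := 0) (y := ⟨w - z, by simp [hzt, hwt]⟩) (by simpa [shift] using hz)
    (by simpa [shift] using hw)
  simpa [shift] using hconst

theorem exists_contDiffOn_factorization (hU : IsOpen U) (l : E →L[ℝ] G) (s : G →L[ℝ] E)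
    (hs : Function.RightInverse s l) (hc : ∀ t, IsPreconnected {z ∈ U | l z = t})
    (hf : ContDiffOn ℝ ∞ f U) (h : ∀ z ∈ U, ∀ v, l v = 0 → dirDeriv v f z = 0) :
    ∃ φ : G → F, ContDiffOn ℝ ∞ φ (l '' U) ∧ ∀ z ∈ U, f z = φ (l z) := by
  have hfibre {z w : E} (hz : z ∈ U) (hw : w ∈ U) (hzw : l z = l w) : f z = f w :=
    eq_of_map_eq_of_dirDeriv_eq_zero hU l (hf.differentiableOn (by simp)) h (hc _) hz hw hzw rfl
  choose! lift hliftU hlift using fun t (ht : t ∈ l '' U) => ht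
  refine ⟨f ∘ lift, ?_, fun z hz =>
    hfibre hz (hliftU _ ⟨z, hz, rfl⟩) (hlift _ ⟨z, hz, rfl⟩).symm⟩
  rintro _ ⟨z, hz, rfl⟩
  let lineLift : G → E := fun t => z + s (t - l z)
  have hline : ContDiff ℝ ∞ lineLift := by fun_prop
  have hbase : lineLift (l z) = z := by simp [lineLift]
  have hmem : ∀ᶠ t in nhds (l z), lineLift t ∈ U :=
    hline.continuous.continuousAt.eventually (by rw [hbase]; exact hU.mem_nhds hz)
  have hsmooth : ContDiffAt ℝ ∞ (f ∘ lineLift) (l z) :=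
    ContDiffAt.comp _ (by rw [hbase]; exact hf.contDiffAt (hU.mem_nhds hz))
      hline.contDiffAt
  refine (hsmooth.congr_of_eventuallyEq ?_).contDiffWithinAt
  filter_upwards [hmem] with t ht
  have hlt : l (lineLift t) = t := by simp [lineLift, hs _]
  have htU : t ∈ l '' U := ⟨_, ht, hlt⟩
  exact hfibre (hliftU t htU) ht ((hlift t htU).trans hlt.symm)

end DirectionalDerivative

section PointSpace

variable {n : ℕ} {D : Set (Base n × ℝ)} {F : Type*} [NormedAddCommGroup F] [NormedSpace ℝ F]

/-- The coordinate direction of `x_μ` in the space of `(t, x, ψ)`, where `x_0 = t`. -/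
abbrev baseDir (μ : Fin (n + 1)) : Base n × ℂ := (Pi.single μ 1, 0)

/-- The direction `w ∂_ψ + w* ∂_{ψ*}` in the space of `(t, x, ψ)`. -/
abbrev psiDir (w : ℂ) : Base n × ℂ := (0, w)

theorem baseDir_add_psiDir (μ : Fin (n + 1)) (w : ℂ) :
    baseDir μ + psiDir w = ((Pi.single μ 1, w) : Base n × ℂ) := by
  simp

theorem eq_sum_baseDir_add_psiDir (v : Base n × ℂ) :
    v = ∑ μ, v.1 μ • baseDir μ + psiDir v.2 := by
  refine Prod.ext ?_ (by simp [Prod.snd_sum])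
  ext μ
  simp [Prod.fst_sum, Finset.sum_apply, Pi.single_apply]

/-- The coordinate `x_μ` on the space of `(t, x, ψ)`, where `x_0 = t`. -/
def coordCLM (n : ℕ) (μ : Fin (n + 1)) : Base n × ℂ →L[ℝ] ℝ :=
  (ContinuousLinearMap.proj μ).comp (ContinuousLinearMap.fst ℝ (Base n) ℂ)

theorem coordCLM_apply (μ : Fin (n + 1)) (z : Base n × ℂ) : coordCLM n μ z = z.1 μ := rfl

theorem isPreconnected_setOf_norm_snd_mem {D' : Set (Base n × ℝ)} (hc : IsPreconnected D')
    (hpos : ∀ p ∈ D', 0 < p.2) : IsPreconnected {z : Base n × ℂ | (z.1, ‖z.2‖) ∈ D'} := by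
  let polar : (Base n × ℝ) × ℝ → Base n × ℂ := fun q =>
    (q.1.1, (q.1.2 : ℂ) * Complex.exp (q.2 * Complex.I))
  have hpolar : Continuous polar := by fun_prop
  convert (hc.prod (isPreconnected_univ (α := ℝ))).image polar hpolar.continuousOn using 1
  ext z
  refine ⟨fun hz => ⟨((z.1, ‖z.2‖), Complex.arg z.2), ⟨hz, trivial⟩,
    Prod.ext rfl (Complex.norm_mul_exp_arg_mul_I z.2)⟩, ?_⟩
  rintro ⟨⟨p, θ⟩, ⟨hp, -⟩, rfl⟩
  have hnorm : ‖(p.2 : ℂ) * Complex.exp (θ * Complex.I)‖ = p.2 := by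
    rw [norm_mul, Complex.norm_exp_ofReal_mul_I, mul_one, Complex.norm_real,
      Real.norm_of_nonneg (hpos p hp).le]
  rw [Set.mem_ofPred_eq, hnorm]
  exact hp

theorem mem_timeSet {z : Base n × ℂ} (hz : z ∈ pointSpace D) : z.1 0 ∈ timeSet D :=
  ⟨_, hz, rfl⟩

theorem rotation_mem_pointSpace {z : Base n × ℂ} (hz : z ∈ pointSpace D) {c : ℂ} (hc : ‖c‖ = 1) :
    (z.1, c * z.2) ∈ pointSpace D := by
  simpa only [pointSpace, Set.mem_ofPred_eq, norm_mul, hc, one_mul] using hz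

namespace IsAdmissibleDomain

variable (hD : IsAdmissibleDomain D)
include hD

theorem isOpen_pointSpace : IsOpen (pointSpace D) :=
  hD.isOpen.preimage (by fun_prop : Continuous fun z : Base n × ℂ => (z.1, ‖z.2‖))

theorem isPreconnected_pointSpace : IsPreconnected (pointSpace D) :=
  isPreconnected_setOf_norm_snd_mem hD.isConnected.isPreconnected hD.rho_pos

theorem isPreconnected_pointSpace_slice (t : ℝ) :
    IsPreconnected {z ∈ pointSpace D | coordCLM n 0 z = t} :=
  isPreconnected_setOf_norm_snd_mem (hD.slice_isPreconnected t) fun p hp => hD.rho_pos p hp.1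

theorem snd_ne_zero {z : Base n × ℂ} (hz : z ∈ pointSpace D) : z.2 ≠ 0 :=
  norm_pos_iff.1 (hD.rho_pos _ hz)

theorem norm_ofReal {p : Base n × ℝ} (hp : p ∈ D) : ‖(p.2 : ℂ)‖ = p.2 := by
  rw [Complex.norm_real, Real.norm_of_nonneg (hD.rho_pos p hp).le]

theorem ofReal_mem_pointSpace {p : Base n × ℝ} (hp : p ∈ D) : (p.1, (p.2 : ℂ)) ∈ pointSpace D := by
  rw [pointSpace, Set.mem_ofPred_eq, hD.norm_ofReal hp]
  exact hp

theorem image_coordCLM_pointSpace : coordCLM n 0 '' pointSpace D = timeSet D := by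
  ext t
  constructor
  · rintro ⟨z, hz, rfl⟩
    exact mem_timeSet hz
  · rintro ⟨p, hp, rfl⟩
    exact ⟨_, hD.ofReal_mem_pointSpace hp, rfl⟩

theorem isOpen_timeSet : IsOpen (timeSet D) := by
  rw [← hD.image_coordCLM_pointSpace]
  exact (coordCLM n 0).isOpenMap (fun t => ⟨t • baseDir 0, by simp [coordCLM_apply]⟩) _
    hD.isOpen_pointSpace

end IsAdmissibleDomain

/-- The functions of `(t, x, ψ)` whose derivatives with respect to `ψ` and `ψ*` vanish on `U`. -/
def IsPsiIndependent (U : Set (Base n × ℂ)) (f : Base n × ℂ → F) : Prop :=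
  ∀ z ∈ U, ∀ w : ℂ, dirDeriv (psiDir w) f z = 0

theorem isPsiIndependent_dirDeriv {U : Set (Base n × ℂ)} {f : Base n × ℂ → F}
    (h : IsPsiIndependent U f) (hU : IsOpen U) (hf : ContDiffOn ℝ ∞ f U) (v : Base n × ℂ) :
    IsPsiIndependent U (dirDeriv v f) := fun z hz w => by
  rw [dirDeriv_comm hU hf hz]
  exact dirDeriv_eq_zero_of_eqOn_const hU (fun z hz => h z hz w) hz v

namespace IsPsiIndependent

variable {U : Set (Base n × ℂ)} {f : Base n × ℂ → F}

theorem dirDeriv_add_psiDir (h : IsPsiIndependent U f) {z : Base n × ℂ} (hz : z ∈ U)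
    (v : Base n × ℂ) (w : ℂ) : dirDeriv (v + psiDir w) f z = dirDeriv v f z := by
  rw [dirDeriv_add_left, h z hz, add_zero]

theorem dirDeriv_eq_sum (h : IsPsiIndependent U f) {z : Base n × ℂ} (hz : z ∈ U)
    (v : Base n × ℂ) : dirDeriv v f z = ∑ μ, v.1 μ • dirDeriv (baseDir μ) f z := by
  conv_lhs => rw [eq_sum_baseDir_add_psiDir v, h.dirDeriv_add_psiDir hz, dirDeriv_sum_left]
  simp only [dirDeriv_smul_left]

theorem apply_rotation {D : Set (Base n × ℝ)} {f : Base n × ℂ → F}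
    (h : IsPsiIndependent (pointSpace D) f) (hD : IsAdmissibleDomain D)
    (hf : DifferentiableOn ℝ f (pointSpace D)) {z : Base n × ℂ} (hz : z ∈ pointSpace D) {c : ℂ}
    (hc : ‖c‖ = 1) : f (z.1, c * z.2) = f z := by
  have hmem (θ : ℝ) : (z.1, Complex.exp (θ * Complex.I) * z.2) ∈ pointSpace D :=
    rotation_mem_pointSpace hz (Complex.norm_exp_ofReal_mul_I θ)
  have hderiv (θ : ℝ) :
      HasDerivAt (fun θ : ℝ => f (z.1, Complex.exp (θ * Complex.I) * z.2)) 0 θ := by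
    have hpath : HasDerivAt (fun θ : ℝ => Complex.exp (θ * Complex.I) * z.2)
        (Complex.exp (θ * Complex.I) * (1 * Complex.I) * z.2) θ :=
      (((Complex.ofRealCLM.hasDerivAt (x := θ)).mul_const Complex.I).cexp).mul_const z.2
    have hcomp := (hf.differentiableAt (hD.isOpen_pointSpace.mem_nhds
      (hmem θ))).hasFDerivAt.comp_hasDerivAt θ ((hasDerivAt_const θ z.1).prodMk hpath)
    rwa [show fderiv ℝ f _ (0, _) = 0 from h _ (hmem θ) _] at hcomp
  have hconst := is_const_of_deriv_eq_zero (fun θ => (hderiv θ).differentiableAt)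
    (fun θ => (hderiv θ).deriv) (Complex.arg c) 0
  have hexp : Complex.exp (Complex.arg c * Complex.I) = c := by
    simpa [hc] using Complex.norm_mul_exp_arg_mul_I c
  simpa [hexp] using hconst

end IsPsiIndependent

theorem IsAdmissibleDomain.exists_eq_comp_time (hD : IsAdmissibleDomain D) {f : Base n × ℂ → F}
    (hf : ContDiffOn ℝ ∞ f (pointSpace D))
    (hx : ∀ z ∈ pointSpace D, ∀ a : Fin n, dirDeriv (baseDir a.succ) f z = 0)
    (hψ : IsPsiIndependent (pointSpace D) f) :
    ∃ φ : ℝ → F, ContDiffOn ℝ ∞ φ (timeSet D) ∧ ∀ z ∈ pointSpace D, f z = φ (z.1 0) := by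
  rw [← hD.image_coordCLM_pointSpace]
  refine exists_contDiffOn_factorization hD.isOpen_pointSpace (coordCLM n 0)
    (ContinuousLinearMap.toSpanSingleton ℝ (baseDir 0)) (fun t => by simp [coordCLM_apply])
    hD.isPreconnected_pointSpace_slice hf fun z hz v hv => ?_
  rw [coordCLM_apply] at hv
  rw [hψ.dirDeriv_eq_sum hz, Fin.sum_univ_succ, hv, zero_smul, zero_add]
  simp only [hx z hz, smul_zero, Finset.sum_const_zero]

theorem IsAdmissibleDomain.exists_eq_add_comp_time (hD : IsAdmissibleDomain D)
    {f g : Base n × ℂ → F} (hf : ContDiffOn ℝ ∞ f (pointSpace D))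
    (hg : ContDiffOn ℝ ∞ g (pointSpace D))
    (hx : ∀ z ∈ pointSpace D, ∀ a : Fin n,
      dirDeriv (baseDir a.succ) f z = dirDeriv (baseDir a.succ) g z)
    (hψ : ∀ z ∈ pointSpace D, ∀ w, dirDeriv (psiDir w) f z = dirDeriv (psiDir w) g z) :
    ∃ φ : ℝ → F, ContDiffOn ℝ ∞ φ (timeSet D) ∧ ∀ z ∈ pointSpace D, f z = g z + φ (z.1 0) := by
  have hsub {z} (hz : z ∈ pointSpace D) (v : Base n × ℂ) :=
    dirDeriv_sub v (differentiableAt_of_contDiffOn hD.isOpen_pointSpace hf hz)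
      (differentiableAt_of_contDiffOn hD.isOpen_pointSpace hg hz)
  obtain ⟨φ, hφ, heq⟩ := hD.exists_eq_comp_time (hf.sub hg)
    (fun z hz a => (hsub hz _).trans (sub_eq_zero.2 (hx z hz a)))
    fun z hz w => (hsub hz _).trans (sub_eq_zero.2 (hψ z hz w))
  exact ⟨φ, hφ, fun z hz => sub_eq_iff_eq_add'.1 (heq z hz)⟩

theorem IsAdmissibleDomain.exists_eq_const (hD : IsAdmissibleDomain D) {f : Base n × ℂ → F}
    (hf : DifferentiableOn ℝ f (pointSpace D))
    (hx : ∀ z ∈ pointSpace D, ∀ μ, dirDeriv (baseDir μ) f z = 0)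
    (hψ : IsPsiIndependent (pointSpace D) f) : ∃ c, ∀ z ∈ pointSpace D, f z = c := by
  refine hD.isOpen_pointSpace.exists_is_const_of_fderiv_eq_zero hD.isPreconnected_pointSpace hf
    fun z hz => ContinuousLinearMap.ext fun v => ?_
  refine (hψ.dirDeriv_eq_sum hz v).trans ?_
  simp only [hx z hz, smul_zero, Finset.sum_const_zero, Pi.zero_apply, _root_.zero_apply]

end PointSpace

section Prolongation

variable {n : ℕ} {U : Set (Base n × ℂ)} {F : Type*} [NormedAddCommGroup F] [NormedSpace ℝ F]

/-- The component of `∂_l` in a vector field: `τ` for `l = 0`, and `ξ^a` for `l = a.succ`. -/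
def baseComp (Q : VField n) (l : Fin (n + 1)) : Base n × ℂ → ℝ := fun z => (Q z).1 l

/-- The component `η` of `∂_ψ` in a vector field. -/
def psiComp (Q : VField n) : Base n × ℂ → ℂ := fun z => (Q z).2

theorem contDiffOn_baseComp {Q : VField n} (hQ : ContDiffOn ℝ ∞ Q U) (l : Fin (n + 1)) :
    ContDiffOn ℝ ∞ (baseComp Q l) U :=
  contDiffOn_pi.1 (contDiff_fst.comp_contDiffOn hQ) l

theorem contDiffOn_psiComp {Q : VField n} (hQ : ContDiffOn ℝ ∞ Q U) :
    ContDiffOn ℝ ∞ (psiComp Q) U :=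
  contDiff_snd.comp_contDiffOn hQ

/-- The direction in the space of `(t, x, ψ)` along which the total derivative `D_μ` differentiates
at a jet with the first derivatives `p`. -/
def totalDir (p : Fin (n + 1) → ℂ) (μ : Fin (n + 1)) : Base n × ℂ :=
  baseDir μ + psiDir (p μ)

/-- The iterated total derivative `D_μ D_ν f` of a function of `(t, x, ψ)` at a jet with the first
derivatives `p` and the second derivatives `q`. -/
def totalDerivSnd (p : Fin (n + 1) → ℂ) (q : Fin (n + 1) → Fin (n + 1) → ℂ) (μ ν : Fin (n + 1))
    (f : Base n × ℂ → F) (z : Base n × ℂ) : F :=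
  dirDeriv (totalDir p μ) (dirDeriv (totalDir p ν) f) z + dirDeriv (psiDir (q μ ν)) f z

/-- The component `η^μ` of the first prolongation, as a function of the jet coordinates. -/
def prolongFst (Q : VField n) (z : Base n × ℂ) (p : Fin (n + 1) → ℂ) (μ : Fin (n + 1)) : ℂ :=
  dirDeriv (totalDir p μ) (psiComp Q) z -
    ∑ l, ((dirDeriv (totalDir p μ) (baseComp Q l) z : ℝ) : ℂ) * p l

/-- The component `η^{μν}` of the second prolongation, as a function of the jet coordinates. -/
def prolongSnd (Q : VField n) (z : Base n × ℂ) (p : Fin (n + 1) → ℂ)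
    (q : Fin (n + 1) → Fin (n + 1) → ℂ) (μ ν : Fin (n + 1)) : ℂ :=
  totalDerivSnd p q μ ν (psiComp Q) z -
    ∑ l, (((totalDerivSnd p q μ ν (baseComp Q l) z : ℝ) : ℂ) * p l +
      ((dirDeriv (totalDir p ν) (baseComp Q l) z : ℝ) : ℂ) * q μ l +
      ((dirDeriv (totalDir p μ) (baseComp Q l) z : ℝ) : ℂ) * q ν l)

section JetProjections

variable (V : Type*) [NormedAddCommGroup V] [NormedSpace ℝ V]

/-- The projection from a jet space to the space of `(t, x, ψ)`; `V` collects the derivatives. -/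
def pointCLM : Base n × ℂ × V →L[ℝ] Base n × ℂ :=
  (ContinuousLinearMap.fst ℝ (Base n) (ℂ × V)).prod
    ((ContinuousLinearMap.fst ℝ ℂ V).comp (ContinuousLinearMap.snd ℝ (Base n) (ℂ × V)))

/-- The projection from a jet space to the space `V` of the derivatives. -/
def derivsCLM : Base n × ℂ × V →L[ℝ] V :=
  (ContinuousLinearMap.snd ℝ ℂ V).comp (ContinuousLinearMap.snd ℝ (Base n) (ℂ × V))

end JetProjections

theorem totalDeriv1_characteristic (hU : IsOpen U) {Q : VField n} (hQ : ContDiffOn ℝ ∞ Q U)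
    (ν : Fin (n + 1)) {j : Jet2 n} (hj : (j.1, j.2.1) ∈ U) :
    totalDeriv1 ν (characteristic Q) j = prolongFst Q (j.1, j.2.1) j.2.2.1 ν -
      ∑ l, (baseComp Q l (j.1, j.2.1) : ℂ) * j.2.2.2 ν l := by
  let π := pointCLM (n := n) (Fin (n + 1) → ℂ)
  let u : Jet1 n := (Pi.single ν 1, j.2.2.1 ν, j.2.2.2 ν)
  let i : Jet1 n := (j.1, j.2.1, j.2.2.1)
  let coord (l : Fin (n + 1)) : Jet1 n →L[ℝ] ℂ :=
    (ContinuousLinearMap.proj l).comp (derivsCLM (Fin (n + 1) → ℂ))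
  have hη : DifferentiableAt ℝ (psiComp Q) (π i) :=
    differentiableAt_of_contDiffOn hU (contDiffOn_psiComp hQ) hj
  have hξ (l) : DifferentiableAt ℝ (baseComp Q l) (π i) :=
    differentiableAt_of_contDiffOn hU (contDiffOn_baseComp hQ l) hj
  have hdir : π u = totalDir j.2.2.1 ν := (baseDir_add_psiDir ν _).symm
  refine (dirDeriv_sub_sum_ofReal_mul u (hη.comp i π.differentiableAt)
    (fun l => (hξ l).comp i π.differentiableAt) coord).trans ?_
  simp only [Function.comp_def, dirDeriv_comp_clm u π hη, dirDeriv_comp_clm u π (hξ _), hdir,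
    Finset.sum_add_distrib, prolongFst, sub_sub]
  rfl

theorem prolong1_eq_prolongFst (hU : IsOpen U) {Q : VField n} (hQ : ContDiffOn ℝ ∞ Q U)
    (μ : Fin (n + 1)) {j : Jet2 n} (hj : (j.1, j.2.1) ∈ U) :
    prolong1 Q μ j = prolongFst Q (j.1, j.2.1) j.2.2.1 μ := by
  rw [prolong1, totalDeriv1_characteristic hU hQ μ hj]
  exact sub_add_cancel _ _

/-- The space of the first and second derivatives of `ψ`. -/
abbrev Derivs2 (n : ℕ) := (Fin (n + 1) → ℂ) × (Fin (n + 1) → Fin (n + 1) → ℂ)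

/-- The jet coordinate `ψ_μ`. -/
def derivFstCLM (μ : Fin (n + 1)) : Derivs2 n →L[ℝ] ℂ :=
  (ContinuousLinearMap.proj μ).comp (ContinuousLinearMap.fst ℝ (Fin (n + 1) → ℂ) _)

/-- The jet coordinate `ψ_{μν}`. -/
def derivSndCLM (μ ν : Fin (n + 1)) : Derivs2 n →L[ℝ] ℂ :=
  (ContinuousLinearMap.proj ν).comp
    ((ContinuousLinearMap.proj (φ := fun _ => Fin (n + 1) → ℂ) μ).comp
      (ContinuousLinearMap.snd ℝ (Fin (n + 1) → ℂ) _))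

theorem differentiableAt_dirDeriv_totalDir (hU : IsOpen U) {f : Base n × ℂ → F}
    (hf : ContDiffOn ℝ ∞ f U) {j : Jet2 n} (hj : (j.1, j.2.1) ∈ U) (ν : Fin (n + 1)) :
    DifferentiableAt ℝ (fun i : Jet2 n => dirDeriv (totalDir i.2.2.1 ν) f (i.1, i.2.1)) j := by
  have hf' : DifferentiableAt ℝ (fun i : Jet2 n => fderiv ℝ f (i.1, i.2.1)) j :=
    (differentiableAt_fderiv hU hf hj).comp j (pointCLM (Derivs2 n)).differentiableAt
  have hdir : DifferentiableAt ℝ (fun i : Jet2 n => totalDir i.2.2.1 ν) j := by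
    unfold totalDir
    fun_prop
  exact hf'.clm_apply hdir

theorem dirDeriv_dirDeriv_totalDir (hU : IsOpen U) {f : Base n × ℂ → F}
    (hf : ContDiffOn ℝ ∞ f U) {j : Jet3 n} (hj : (j.1, j.2.1) ∈ U) (μ ν : Fin (n + 1)) :
    dirDeriv (Pi.single μ 1, j.2.2.1 μ, j.2.2.2.1 μ, j.2.2.2.2 μ)
        (fun i : Jet2 n => dirDeriv (totalDir i.2.2.1 ν) f (i.1, i.2.1)) j.toJet2 =
      totalDerivSnd j.2.2.1 j.2.2.2.1 μ ν f (j.1, j.2.1) := by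
  let c : Jet2 n →L[ℝ] Base n × ℂ := (ContinuousLinearMap.inr ℝ (Base n) ℂ).comp
    ((derivFstCLM ν).comp (derivsCLM (Derivs2 n)))
  have hdir : baseDir μ + psiDir (j.2.2.1 μ) = ((Pi.single μ 1, j.2.2.1 μ) : Base n × ℂ) :=
    baseDir_add_psiDir μ _
  rw [totalDerivSnd, totalDir, hdir]
  exact dirDeriv_fderiv_apply hU hf (pointCLM (Derivs2 n)) c (baseDir ν) (y := j.toJet2) hj _

theorem totalDeriv2_totalDeriv1_characteristic (hU : IsOpen U) {Q : VField n}
    (hQ : ContDiffOn ℝ ∞ Q U) (μ ν : Fin (n + 1)) {j : Jet3 n} (hj : (j.1, j.2.1) ∈ U) :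
    totalDeriv2 μ (totalDeriv1 ν (characteristic Q)) j =
      prolongSnd Q (j.1, j.2.1) j.2.2.1 j.2.2.2.1 μ ν -
        ∑ l, (baseComp Q l (j.1, j.2.1) : ℂ) * j.2.2.2.2 μ ν l := by
  let π := pointCLM (n := n) (Derivs2 n)
  let u : Jet2 n := (Pi.single μ 1, j.2.2.1 μ, j.2.2.2.1 μ, j.2.2.2.2 μ)
  let coordFst (l : Fin (n + 1)) := (derivFstCLM l).comp (derivsCLM (n := n) (Derivs2 n))
  let coordSnd (l : Fin (n + 1)) := (derivSndCLM ν l).comp (derivsCLM (n := n) (Derivs2 n))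
  have hη := differentiableAt_dirDeriv_totalDir hU (contDiffOn_psiComp hQ) (j := j.toJet2) hj ν
  have hderivξ (l) :=
    differentiableAt_dirDeriv_totalDir hU (contDiffOn_baseComp hQ l) (j := j.toJet2) hj ν
  have hξ (l) : DifferentiableAt ℝ (baseComp Q l) (π j.toJet2) :=
    differentiableAt_of_contDiffOn hU (contDiffOn_baseComp hQ l) hj
  have hdir : π u = totalDir j.2.2.1 μ := (baseDir_add_psiDir μ _).symm
  have hfst : Set.EqOn (totalDeriv1 ν (characteristic Q)) _ (π ⁻¹' U) :=
    fun _ hi => totalDeriv1_characteristic hU hQ ν hi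
  refine (dirDeriv_congr (hU.preimage π.continuous) hfst u hj).trans ?_
  refine (dirDeriv_sub_sum_ofReal_mul u (differentiableAt_sub_sum_ofReal_mul hη hderivξ coordFst)
    (fun l => (hξ l).comp j.toJet2 π.differentiableAt) coordSnd).trans ?_
  rw [dirDeriv_sub_sum_ofReal_mul u hη hderivξ coordFst]
  simp only [u, Function.comp_def, dirDeriv_dirDeriv_totalDir hU (contDiffOn_psiComp hQ) hj,
    dirDeriv_dirDeriv_totalDir hU (contDiffOn_baseComp hQ _) hj, prolongSnd, sub_sub,
    ← Finset.sum_add_distrib, add_assoc]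
  congr 1
  refine Finset.sum_congr rfl fun l _ => ?_
  rw [dirDeriv_comp_clm _ π (hξ l), hdir]
  rfl

theorem prolong2_eq_prolongSnd (hU : IsOpen U) {Q : VField n} (hQ : ContDiffOn ℝ ∞ Q U)
    (μ ν : Fin (n + 1)) {j : Jet3 n} (hj : (j.1, j.2.1) ∈ U) :
    prolong2 Q μ ν j = prolongSnd Q (j.1, j.2.1) j.2.2.1 j.2.2.2.1 μ ν := by
  rw [prolong2, totalDeriv2_totalDeriv1_characteristic hU hQ μ ν hj]
  exact sub_add_cancel _ _

/-- The term `S(t, x, |ψ|) ψ` of the equation. -/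
def nonlinearTerm (S : Base n × ℝ → ℂ) (z : Base n × ℂ) : ℂ := S (z.1, ‖z.2‖) * z.2

/-- The infinitesimal invariance criterion at the jet `(z, p, q)`, with the derivatives of the
components of `Q` written out. -/
def criterion (S : Base n × ℝ → ℂ) (Q : VField n) (z : Base n × ℂ) (p : Fin (n + 1) → ℂ)
    (q : Fin (n + 1) → Fin (n + 1) → ℂ) : ℂ :=
  Complex.I * prolongFst Q z p 0 + ∑ a : Fin n, prolongSnd Q z p q a.succ a.succ +
    dirDeriv (Q z) (nonlinearTerm S) z

section AdmissibleDomain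

variable {D : Set (Base n × ℝ)} {S : Base n × ℝ → ℂ} {Q : VField n}

theorem differentiableAt_nonlinearTerm (hD : IsAdmissibleDomain D) (hS : ContDiffOn ℝ ∞ S D)
    {z : Base n × ℂ} (hz : z ∈ pointSpace D) : DifferentiableAt ℝ (nonlinearTerm S) z := by
  have hnorm : DifferentiableAt ℝ (fun z : Base n × ℂ => (z.1, ‖z.2‖)) z :=
    differentiableAt_fst.prodMk (differentiableAt_snd.norm ℝ (hD.snd_ne_zero hz))
  have hSd : DifferentiableAt ℝ S (z.1, ‖z.2‖) := differentiableAt_of_contDiffOn hD.isOpen hS hz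
  exact (hSd.comp z hnorm).mul differentiableAt_snd

theorem fderiv_eqnLHS_prolong (hD : IsAdmissibleDomain D) (hS : ContDiffOn ℝ ∞ S D)
    (hQ : ContDiffOn ℝ ∞ Q (pointSpace D)) {j : Jet3 n} (hj : (j.1, j.2.1) ∈ pointSpace D) :
    fderiv ℝ (eqnLHS S) j.toJet2 (prolong Q j) =
      criterion S Q (j.1, j.2.1) j.2.2.1 j.2.2.2.1 := by
  let L : Derivs2 n →L[ℝ] ℂ :=
    Complex.I • derivFstCLM 0 + ∑ a : Fin n, derivSndCLM a.succ a.succ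
  let π := pointCLM (n := n) (Derivs2 n)
  have hL (y : Derivs2 n) : L y = Complex.I * y.1 0 + ∑ a : Fin n, y.2 a.succ a.succ := by
    simp [L, derivFstCLM, derivSndCLM]
  have hlhs : eqnLHS S = fun i => L.comp (derivsCLM (Derivs2 n)) i + nonlinearTerm S (π i) := by
    funext i
    rw [ContinuousLinearMap.comp_apply, hL]
    rfl
  have hN : DifferentiableAt ℝ (nonlinearTerm S) (π j.toJet2) :=
    differentiableAt_nonlinearTerm hD hS hj
  calc fderiv ℝ (eqnLHS S) j.toJet2 (prolong Q j)
      = L (derivsCLM _ (prolong Q j)) + dirDeriv (Q (j.1, j.2.1)) (nonlinearTerm S) (j.1, j.2.1) :=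
        by
          rw [hlhs]
          refine (dirDeriv_add (prolong Q j) (ContinuousLinearMap.differentiableAt _)
            (hN.comp j.toJet2 π.differentiableAt)).trans ?_
          rw [dirDeriv_clm]
          exact congrArg _ (dirDeriv_comp_clm (prolong Q j) π hN)
    _ = _ := by
      have hfst : prolong1 Q 0 j.toJet2 = prolongFst Q (j.1, j.2.1) j.2.2.1 0 :=
        prolong1_eq_prolongFst hD.isOpen_pointSpace hQ 0 hj
      rw [hL, criterion, ← hfst]
      simp only [← prolong2_eq_prolongSnd hD.isOpen_pointSpace hQ _ _ hj]
      rfl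

/-- The criterion holds at all jets over `z` that satisfy the equation. -/
def CriterionAt (S : Base n × ℝ → ℂ) (Q : VField n) (z : Base n × ℂ) : Prop :=
  ∀ (p : Fin (n + 1) → ℂ) (q : Fin (n + 1) → Fin (n + 1) → ℂ), (∀ μ ν, q μ ν = q ν μ) →
    Complex.I * p 0 + ∑ a : Fin n, q a.succ a.succ + nonlinearTerm S z = 0 →
    criterion S Q z p q = 0

theorem mem_maximalLieInvarianceAlgebra_iff_criterionAt (hD : IsAdmissibleDomain D)
    (hS : ContDiffOn ℝ ∞ S D) :
    Q ∈ maximalLieInvarianceAlgebra D S ↔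
      ContDiffOn ℝ ∞ Q (pointSpace D) ∧ ∀ z ∈ pointSpace D, CriterionAt S Q z := by
  refine and_congr_right fun hQ => ⟨fun h z hz p q hq he => ?_, fun h j hj hz he => ?_⟩
  · rw [← h (z.1, z.2, p, q, 0) ⟨hq, fun _ _ _ => rfl, fun _ _ _ => rfl⟩ hz he,
      fderiv_eqnLHS_prolong hD hS hQ hz]
  · rw [fderiv_eqnLHS_prolong hD hS hQ hz]
    exact h _ hz _ _ hj.1 he

end AdmissibleDomain

end Prolongation

section DeterminingEquations

variable {n : ℕ} {U : Set (Base n × ℂ)} {F : Type*} [NormedAddCommGroup F] [NormedSpace ℝ F]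
  {S : Base n × ℝ → ℂ} {Q : VField n}

theorem psiDir_zero : (psiDir 0 : Base n × ℂ) = 0 := rfl

theorem dirDeriv_psiDir_eq_re_add_im (f : Base n × ℂ → F) (z : Base n × ℂ) (w : ℂ) :
    dirDeriv (psiDir w) f z =
      w.re • dirDeriv (psiDir 1) f z + w.im • dirDeriv (psiDir Complex.I) f z := by
  rw [← dirDeriv_smul_left, ← dirDeriv_smul_left, ← dirDeriv_add_left]
  congr 1
  ext <;> simp

theorem prolongSnd_eq_add (z : Base n × ℂ) (p : Fin (n + 1) → ℂ)
    (q : Fin (n + 1) → Fin (n + 1) → ℂ) (μ : Fin (n + 1)) :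
    prolongSnd Q z p q μ μ = prolongSnd Q z p 0 μ μ + (dirDeriv (psiDir (q μ μ)) (psiComp Q) z -
      ∑ l, (((dirDeriv (psiDir (q μ μ)) (baseComp Q l) z : ℝ) : ℂ) * p l +
        2 * ((dirDeriv (totalDir p μ) (baseComp Q l) z : ℝ) : ℂ) * q μ l)) := by
  simp only [prolongSnd, totalDerivSnd, Pi.zero_apply, psiDir_zero, dirDeriv_zero_left, add_zero,
    mul_zero, Complex.ofReal_add, add_mul, Finset.sum_add_distrib, mul_assoc, ← Finset.mul_sum]
  ring

theorem criterion_eq_add (z : Base n × ℂ) (p : Fin (n + 1) → ℂ)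
    (q : Fin (n + 1) → Fin (n + 1) → ℂ) :
    criterion S Q z p q = criterion S Q z p 0 +
      ∑ a : Fin n, (dirDeriv (psiDir (q a.succ a.succ)) (psiComp Q) z -
        ∑ l, (((dirDeriv (psiDir (q a.succ a.succ)) (baseComp Q l) z : ℝ) : ℂ) * p l +
          2 * ((dirDeriv (totalDir p a.succ) (baseComp Q l) z : ℝ) : ℂ) * q a.succ l)) := by
  simp only [criterion, prolongSnd_eq_add z p q, Finset.sum_add_distrib]
  ring

/-- The value of `ψ_t` for which the equation holds at jets whose second derivatives vanish. -/
def freeTimeDeriv (S : Base n × ℝ → ℂ) (z : Base n × ℂ) : ℂ := Complex.I * nonlinearTerm S z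

theorem I_mul_freeTimeDeriv (z : Base n × ℂ) :
    Complex.I * freeTimeDeriv S z + nonlinearTerm S z = 0 := by
  rw [freeTimeDeriv, ← mul_assoc, Complex.I_mul_I]
  ring

namespace CriterionAt

variable {z : Base n × ℂ} (h : CriterionAt S Q z)
include h

theorem criterion_cons_zero (r : Fin n → ℂ) :
    criterion S Q z (Fin.cons (freeTimeDeriv S z) r) 0 = 0 :=
  h _ _ (fun _ _ => rfl) (by simpa using I_mul_freeTimeDeriv z)

theorem sum_offdiag_eq_zero (r : Fin n → ℂ) {q : Fin (n + 1) → Fin (n + 1) → ℂ}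
    (hdiag : ∀ a : Fin n, q a.succ a.succ = 0) (hsymm : ∀ μ ν, q μ ν = q ν μ) :
    ∑ a : Fin n, ∑ l,
      ((dirDeriv (baseDir a.succ + psiDir (r a)) (baseComp Q l) z : ℝ) : ℂ) * q a.succ l = 0 := by
  have heq := criterion_eq_add (S := S) (Q := Q) z (Fin.cons (freeTimeDeriv S z) r) q
  rw [h.criterion_cons_zero, h _ _ hsymm (by simpa [hdiag] using I_mul_freeTimeDeriv z)] at heq
  simpa [hdiag, psiDir_zero, dirDeriv_zero_left, totalDir, mul_assoc, ← Finset.mul_sum] using heq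

theorem dirDeriv_baseComp_zero_eq_zero (a : Fin n) (w : ℂ) :
    dirDeriv (baseDir a.succ + psiDir w) (baseComp Q 0) z = 0 := by
  let q (μ ν : Fin (n + 1)) : ℂ := (if μ = a.succ then if ν = 0 then 1 else 0 else 0) +
    (if ν = a.succ then if μ = 0 then 1 else 0 else 0)
  have hsum := h.sum_offdiag_eq_zero (fun _ => w) (q := q) (by simp [q]) fun _ _ => add_comm _ _
  simpa [q, mul_add, Finset.sum_add_distrib] using hsum

theorem killing_offdiag {a b : Fin n} (hab : a ≠ b) :
    dirDeriv (baseDir a.succ) (baseComp Q b.succ) z +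
      dirDeriv (baseDir b.succ) (baseComp Q a.succ) z = 0 := by
  let q (μ ν : Fin (n + 1)) : ℂ := (if μ = a.succ then if ν = b.succ then 1 else 0 else 0) +
    (if ν = a.succ then if μ = b.succ then 1 else 0 else 0)
  have hdiag (c : Fin n) : q c.succ c.succ = 0 := by
    by_cases hc : c = a
    · simp [q, hc, hab]
    · simp [q, hc]
  have hsum := h.sum_offdiag_eq_zero 0 hdiag fun _ _ => add_comm _ _
  exact_mod_cast (by
    simpa [q, mul_add, mul_ite, Finset.sum_add_distrib, psiDir_zero] using hsum :
    ((dirDeriv (baseDir a.succ) (baseComp Q b.succ) z : ℝ) : ℂ) +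
      ((dirDeriv (baseDir b.succ) (baseComp Q a.succ) z : ℝ) : ℂ) = 0)

section Diagonal

variable (hτψ : ∀ w, dirDeriv (psiDir w) (baseComp Q 0) z = 0)
  (hτaa : ∀ (a : Fin n) (w : ℂ), dirDeriv (baseDir a.succ + psiDir w)
    (dirDeriv (baseDir a.succ + psiDir w) (baseComp Q 0)) z = 0)
include hτψ hτaa

omit h in
theorem criterion_cons_add (c u : ℂ) (r : Fin n → ℂ) :
    criterion S Q z (Fin.cons (c + u) r) 0 = criterion S Q z (Fin.cons c r) 0 +
      Complex.I * (dirDeriv (psiDir u) (psiComp Q) z -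
        ((dirDeriv (baseDir 0) (baseComp Q 0) z : ℝ) : ℂ) * u -
        ∑ a : Fin n, ((dirDeriv (psiDir u) (baseComp Q a.succ) z : ℝ) : ℂ) * r a) := by
  have hdir : (psiDir (c + u) : Base n × ℂ) = psiDir c + psiDir u := by simp
  have hfst : prolongFst Q z (Fin.cons (c + u) r) 0 = prolongFst Q z (Fin.cons c r) 0 +
      (dirDeriv (psiDir u) (psiComp Q) z -
        ((dirDeriv (baseDir 0) (baseComp Q 0) z : ℝ) : ℂ) * u -
        ∑ a : Fin n, ((dirDeriv (psiDir u) (baseComp Q a.succ) z : ℝ) : ℂ) * r a) := by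
    simp only [prolongFst, totalDir, Fin.sum_univ_succ, Fin.cons_zero, Fin.cons_succ, hdir,
      dirDeriv_add_left, hτψ, Complex.ofReal_zero, Complex.ofReal_add, add_mul,
      Finset.sum_add_distrib]
    ring
  have hsnd (a : Fin n) : prolongSnd Q z (Fin.cons (c + u) r) 0 a.succ a.succ =
      prolongSnd Q z (Fin.cons c r) 0 a.succ a.succ := by
    simp only [prolongSnd, totalDerivSnd, totalDir, Fin.sum_univ_succ, Fin.cons_zero,
      Fin.cons_succ, hτaa, psiDir_zero, dirDeriv_zero_left, Pi.zero_apply, add_zero,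
      Complex.ofReal_zero, zero_mul]
  simp only [criterion, hfst, hsnd]
  ring

theorem criterion_diag_eq_zero (a : Fin n) (v w : ℂ) :
    Complex.I * (dirDeriv (psiDir (Complex.I * w)) (psiComp Q) z -
        ((dirDeriv (baseDir 0) (baseComp Q 0) z : ℝ) : ℂ) * (Complex.I * w) -
        ((dirDeriv (psiDir (Complex.I * w)) (baseComp Q a.succ) z : ℝ) : ℂ) * v) +
      (dirDeriv (psiDir w) (psiComp Q) z -
        ((dirDeriv (psiDir w) (baseComp Q a.succ) z : ℝ) : ℂ) * v -
        2 * ((dirDeriv (baseDir a.succ + psiDir v) (baseComp Q a.succ) z : ℝ) : ℂ) * w) = 0 := by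
  let r : Fin n → ℂ := Pi.single a v
  let q (μ ν : Fin (n + 1)) : ℂ := if μ = ν then if μ = a.succ then w else 0 else 0
  have hcrit := h (Fin.cons (freeTimeDeriv S z + Complex.I * w) r) q
    (fun μ ν => by by_cases hμν : μ = ν <;> simp [q, hμν, eq_comm])
    (by
      simp only [q, Fin.cons_zero, mul_add, ← mul_assoc, Complex.I_mul_I, neg_mul, one_mul,
        ↓reduceIte, Fin.succ_inj, Finset.sum_ite_eq', Finset.mem_univ, neg_add_cancel_right]
      linear_combination I_mul_freeTimeDeriv (S := S) z)
  rw [criterion_eq_add, criterion_cons_add hτψ hτaa, h.criterion_cons_zero,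
    Finset.sum_eq_single a (fun b _ hb => by simp [r, hb]) (by simp),
    Finset.sum_eq_single a (fun b _ hb => by simp [q, hb, psiDir_zero, dirDeriv_zero_left])
      (by simp)] at hcrit
  simpa [q, r, totalDir, Fin.sum_univ_succ, Pi.single_apply, Finset.sum_add_distrib,
    hτψ, ← sub_sub] using hcrit

theorem dirDeriv_psiDir_baseComp_succ_eq_zero (a : Fin n) (w : ℂ) :
    dirDeriv (psiDir w) (baseComp Q a.succ) z = 0 := by
  have hone := h.criterion_diag_eq_zero hτψ hτaa a 1 1
  have hzero := h.criterion_diag_eq_zero hτψ hτaa a 0 1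
  simp only [dirDeriv_add_left, Complex.ofReal_add, psiDir_zero, dirDeriv_zero_left,
    Complex.ofReal_zero, mul_one] at hone hzero
  have hξ : Complex.I * ((dirDeriv (psiDir Complex.I) (baseComp Q a.succ) z : ℝ) : ℂ) +
      3 * ((dirDeriv (psiDir 1) (baseComp Q a.succ) z : ℝ) : ℂ) = 0 := by
    linear_combination hzero - hone
  have hre : dirDeriv (psiDir 1) (baseComp Q a.succ) z = 0 := by
    simpa using congrArg Complex.re hξ
  have him : dirDeriv (psiDir Complex.I) (baseComp Q a.succ) z = 0 := by
    simpa using congrArg Complex.im hξ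
  rw [dirDeriv_psiDir_eq_re_add_im, hre, him, smul_zero, smul_zero, add_zero]

theorem two_mul_killing_diag_and_holomorphic (a : Fin n) :
    2 * dirDeriv (baseDir a.succ) (baseComp Q a.succ) z = dirDeriv (baseDir 0) (baseComp Q 0) z ∧
      dirDeriv (psiDir Complex.I) (psiComp Q) z =
        Complex.I * dirDeriv (psiDir 1) (psiComp Q) z := by
  -- Over `ℂ` the relations for `w = 1` and `w = I` separate the conformal factor of `ξ` from the
  -- Cauchy–Riemann equation for `η`.
  have hone := h.criterion_diag_eq_zero hτψ hτaa a 0 1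
  have hI := h.criterion_diag_eq_zero hτψ hτaa a 0 Complex.I
  have hneg : (psiDir (-1) : Base n × ℂ) = (-1 : ℝ) • psiDir 1 := by simp
  simp only [psiDir_zero, add_zero, mul_one, mul_zero, sub_zero] at hone hI
  rw [Complex.I_mul_I, hneg, dirDeriv_smul_left, neg_one_smul] at hI
  set T : ℂ := ((dirDeriv (baseDir 0) (baseComp Q 0) z : ℝ) : ℂ)
  set X : ℂ := ((dirDeriv (baseDir a.succ) (baseComp Q a.succ) z : ℝ) : ℂ)
  set A := dirDeriv (psiDir 1) (psiComp Q) z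
  set B := dirDeriv (psiDir Complex.I) (psiComp Q) z
  have hone' : Complex.I * B + T + A - 2 * X = 0 := by
    linear_combination hone + T * Complex.I_mul_I
  refine ⟨?_, ?_⟩
  · have hX : 2 * X = T := by
      linear_combination (-1 / 2 : ℂ) * (hone' - Complex.I * hI) +
        (1 / 2 : ℂ) * (A - T + 2 * X) * Complex.I_mul_I
    exact Complex.ofReal_injective (by rwa [Complex.ofReal_mul, Complex.ofReal_ofNat])
  · linear_combination (1 / 2 : ℂ) * (hI - Complex.I * hone') +
      (1 / 2 : ℂ) * B * Complex.I_mul_I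

end Diagonal

end CriterionAt

/-- The coefficient `η_ψ`: when `η` is affine and holomorphic in `ψ`, it is the factor of `ψ`. -/
def psiCoeff (Q : VField n) : Base n × ℂ → ℂ := dirDeriv (psiDir 1) (psiComp Q)

theorem contDiffOn_psiCoeff (hU : IsOpen U) (hQ : ContDiffOn ℝ ∞ Q U) :
    ContDiffOn ℝ ∞ (psiCoeff Q) U :=
  contDiffOn_dirDeriv hU (contDiffOn_psiComp hQ) _

/-- The determining equations of first order in the components of `Q`: `τ` depends on `t` only, `ξ`
is independent of `ψ` and conformal Killing in `x`, and `η` is holomorphic in `ψ`. -/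
structure FirstOrderEqs (U : Set (Base n × ℂ)) (Q : VField n) : Prop where
  time : ∀ z ∈ U, ∀ a : Fin n, dirDeriv (baseDir a.succ) (baseComp Q 0) z = 0
  base_psi : ∀ l, IsPsiIndependent U (baseComp Q l)
  killing : ∀ z ∈ U, ∀ a b : Fin n,
    dirDeriv (baseDir a.succ) (baseComp Q b.succ) z +
      dirDeriv (baseDir b.succ) (baseComp Q a.succ) z =
        if a = b then dirDeriv (baseDir 0) (baseComp Q 0) z else 0
  holomorphic : ∀ z ∈ U, ∀ w, dirDeriv (psiDir w) (psiComp Q) z = w * psiCoeff Q z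

theorem firstOrderEqs_of_criterionAt (hn : 1 ≤ n) (hU : IsOpen U)
    (h : ∀ z ∈ U, CriterionAt S Q z) : FirstOrderEqs U Q := by
  have htime (z) (hz : z ∈ U) (a : Fin n) : dirDeriv (baseDir a.succ) (baseComp Q 0) z = 0 := by
    simpa using (h z hz).dirDeriv_baseComp_zero_eq_zero a 0
  have hτψ (z) (hz : z ∈ U) (w : ℂ) : dirDeriv (psiDir w) (baseComp Q 0) z = 0 := by
    have hsum := (h z hz).dirDeriv_baseComp_zero_eq_zero ⟨0, hn⟩ w
    rwa [dirDeriv_add_left, htime z hz, zero_add] at hsum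
  have hτaa (z) (hz : z ∈ U) (a : Fin n) (w : ℂ) := dirDeriv_eq_zero_of_eqOn_const hU
    (fun z hz => (h z hz).dirDeriv_baseComp_zero_eq_zero a w) hz (baseDir a.succ + psiDir w)
  have hdiag (z) (hz : z ∈ U) :=
    (h z hz).two_mul_killing_diag_and_holomorphic (hτψ z hz) (hτaa z hz)
  refine ⟨htime, fun l z hz w => ?_, fun z hz a b => ?_, fun z hz w => ?_⟩
  · refine Fin.cases (hτψ z hz w) (fun a => ?_) l
    exact (h z hz).dirDeriv_psiDir_baseComp_succ_eq_zero (hτψ z hz) (hτaa z hz) a w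
  · split_ifs with hab
    · rw [hab, ← two_mul, (hdiag z hz b).1]
    · exact (h z hz).killing_offdiag hab
  · rw [dirDeriv_psiDir_eq_re_add_im, (hdiag z hz ⟨0, hn⟩).2, psiCoeff]
    conv_rhs => rw [← Complex.re_add_im w]
    simp only [Complex.real_smul]
    ring

/-- The free Schrödinger operator `i ∂_t + ∂_a ∂_a` on functions of `(t, x, ψ)`. -/
def schrodingerOp (f : Base n × ℂ → ℂ) (z : Base n × ℂ) : ℂ :=
  Complex.I * dirDeriv (baseDir 0) f z +
    ∑ a : Fin n, dirDeriv (baseDir a.succ) (dirDeriv (baseDir a.succ) f) z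

/-- The part of the criterion that is independent of the derivatives of `ψ`. -/
def zeroOrderPart (S : Base n × ℝ → ℂ) (Q : VField n) (z : Base n × ℂ) : ℂ :=
  schrodingerOp (psiComp Q) z +
    (((dirDeriv (baseDir 0) (baseComp Q 0) z : ℝ) : ℂ) - psiCoeff Q z) * nonlinearTerm S z +
    dirDeriv (Q z) (nonlinearTerm S) z

namespace FirstOrderEqs

variable (hF : FirstOrderEqs U Q) {z : Base n × ℂ} (hz : z ∈ U)
include hF hz

theorem killing_sum_mul {q : Fin n → Fin n → ℂ} (hq : ∀ a b, q a b = q b a) :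
    2 * ∑ a, ∑ b, ((dirDeriv (baseDir a.succ) (baseComp Q b.succ) z : ℝ) : ℂ) * q a b =
      ((dirDeriv (baseDir 0) (baseComp Q 0) z : ℝ) : ℂ) * ∑ a, q a a := by
  let X (a b : Fin n) : ℂ := ((dirDeriv (baseDir a.succ) (baseComp Q b.succ) z : ℝ) : ℂ)
  have hkill (a b : Fin n) : X a b + X b a =
      if a = b then ((dirDeriv (baseDir 0) (baseComp Q 0) z : ℝ) : ℂ) else 0 := by
    simp only [X, ← Complex.ofReal_add, hF.killing z hz a b, apply_ite Complex.ofReal,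
      Complex.ofReal_zero]
  have hswap : ∑ a, ∑ b, X a b * q a b = ∑ a, ∑ b, X b a * q a b := by
    rw [Finset.sum_comm]
    simp only [hq]
  calc 2 * ∑ a, ∑ b, X a b * q a b
      = ∑ a, ∑ b, (X a b + X b a) * q a b := by
        simp only [add_mul, Finset.sum_add_distrib, ← hswap, two_mul]
    _ = _ := by simp [hkill, Finset.mul_sum]

theorem prolongFst_zero (p : Fin (n + 1) → ℂ) :
    prolongFst Q z p 0 = dirDeriv (baseDir 0) (psiComp Q) z + p 0 * psiCoeff Q z -
      (((dirDeriv (baseDir 0) (baseComp Q 0) z : ℝ) : ℂ) * p 0 +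
        ∑ a : Fin n, ((dirDeriv (baseDir 0) (baseComp Q a.succ) z : ℝ) : ℂ) * p a.succ) := by
  simp only [prolongFst, totalDir, (hF.base_psi _).dirDeriv_add_psiDir hz, dirDeriv_add_left _ _
    (psiComp Q), hF.holomorphic z hz, Fin.sum_univ_succ]

section SecondDerivatives

variable (hU : IsOpen U) (hQ : ContDiffOn ℝ ∞ Q U)
include hU hQ

theorem dirDeriv_dirDeriv_baseComp_zero (u : Base n × ℂ) (a : Fin n) :
    dirDeriv (baseDir a.succ) (dirDeriv u (baseComp Q 0)) z = 0 := by
  rw [dirDeriv_comm hU (contDiffOn_baseComp hQ 0) hz]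
  exact dirDeriv_eq_zero_of_eqOn_const hU (fun z hz => hF.time z hz a) hz u

theorem dirDeriv_dirDeriv_baseComp_succ (a b c : Fin n) :
    dirDeriv (baseDir b.succ) (dirDeriv (baseDir c.succ) (baseComp Q a.succ)) z = 0 := by
  let X (b c a : Fin n) : ℝ :=
    dirDeriv (baseDir b.succ) (dirDeriv (baseDir c.succ) (baseComp Q a.succ)) z
  have hsymm (b c a : Fin n) : X b c a = X c b a :=
    dirDeriv_comm hU (contDiffOn_baseComp hQ a.succ) hz _ _
  have hdiff (b c : Fin n) :
      DifferentiableAt ℝ (dirDeriv (baseDir b.succ) (baseComp Q c.succ)) z :=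
    differentiableAt_of_contDiffOn hU (contDiffOn_dirDeriv hU (contDiffOn_baseComp hQ _) _) hz
  have hkill (a b c : Fin n) : X c a b + X c b a = 0 := by
    refine (dirDeriv_add _ (hdiff a b) (hdiff b a)).symm.trans
      ((dirDeriv_congr hU (fun z hz => hF.killing z hz a b) _ hz).trans ?_)
    split_ifs
    · exact hF.dirDeriv_dirDeriv_baseComp_zero hz hU hQ _ c
    · exact dirDeriv_eq_zero_of_eqOn_const hU (fun _ _ => rfl) hz _
  linarith [hkill a b c, hkill b c a, hkill c a b, hsymm a b c, hsymm b c a, hsymm c a b]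

theorem dirDeriv_dirDeriv_psiDir_psiComp (u : Base n × ℂ) (w : ℂ) :
    dirDeriv u (dirDeriv (psiDir w) (psiComp Q)) z = w * dirDeriv u (psiCoeff Q) z :=
  (dirDeriv_congr hU (fun z hz => hF.holomorphic z hz w) u hz).trans
    (dirDeriv_clm_comp u (ContinuousLinearMap.mul ℝ ℂ w)
      (differentiableAt_of_contDiffOn hU (contDiffOn_psiCoeff hU hQ) hz))

theorem dirDeriv_psiDir_psiCoeff (w : ℂ) :
    dirDeriv (psiDir w) (psiCoeff Q) z = w * dirDeriv (psiDir 1) (psiCoeff Q) z := by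
  rw [← hF.dirDeriv_dirDeriv_psiDir_psiComp hz hU hQ]
  exact dirDeriv_comm hU (contDiffOn_psiComp hQ) hz _ _

theorem totalDerivSnd_baseComp (p : Fin (n + 1) → ℂ) (q : Fin (n + 1) → Fin (n + 1) → ℂ)
    (a : Fin n) (l : Fin (n + 1)) : totalDerivSnd p q a.succ a.succ (baseComp Q l) z = 0 := by
  have hψ (u : Base n × ℂ) (w : ℂ) : dirDeriv u (dirDeriv (psiDir w) (baseComp Q l)) z = 0 :=
    dirDeriv_eq_zero_of_eqOn_const hU (fun z hz => hF.base_psi l z hz w) hz u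
  rw [totalDerivSnd, totalDir, dirDeriv_dirDeriv_add_self hU (contDiffOn_baseComp hQ l) hz, hψ, hψ,
    hF.base_psi l z hz, smul_zero, add_zero, add_zero, add_zero]
  exact Fin.cases (hF.dirDeriv_dirDeriv_baseComp_zero hz hU hQ _ a)
    (fun b => hF.dirDeriv_dirDeriv_baseComp_succ hz hU hQ b a a) l

theorem totalDerivSnd_psiComp (p : Fin (n + 1) → ℂ) (q : Fin (n + 1) → Fin (n + 1) → ℂ)
    (μ : Fin (n + 1)) : totalDerivSnd p q μ μ (psiComp Q) z =
      dirDeriv (baseDir μ) (dirDeriv (baseDir μ) (psiComp Q)) z +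
        2 * (p μ * dirDeriv (baseDir μ) (psiCoeff Q) z) +
        p μ ^ 2 * dirDeriv (psiDir 1) (psiCoeff Q) z + q μ μ * psiCoeff Q z := by
  rw [totalDerivSnd, totalDir, dirDeriv_dirDeriv_add_self hU (contDiffOn_psiComp hQ) hz,
    hF.dirDeriv_dirDeriv_psiDir_psiComp hz hU hQ, hF.dirDeriv_dirDeriv_psiDir_psiComp hz hU hQ,
    hF.dirDeriv_psiDir_psiCoeff hz hU hQ, hF.holomorphic z hz, Complex.real_smul,
    Complex.ofReal_ofNat]
  ring

theorem prolongSnd_succ (p : Fin (n + 1) → ℂ) (q : Fin (n + 1) → Fin (n + 1) → ℂ) (a : Fin n) :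
    prolongSnd Q z p q a.succ a.succ =
      dirDeriv (baseDir a.succ) (dirDeriv (baseDir a.succ) (psiComp Q)) z +
        2 * (p a.succ * dirDeriv (baseDir a.succ) (psiCoeff Q) z) +
        p a.succ ^ 2 * dirDeriv (psiDir 1) (psiCoeff Q) z + q a.succ a.succ * psiCoeff Q z -
      2 * ∑ b : Fin n, ((dirDeriv (baseDir a.succ) (baseComp Q b.succ) z : ℝ) : ℂ) *
        q a.succ b.succ := by
  simp only [prolongSnd, totalDir, (hF.base_psi _).dirDeriv_add_psiDir hz,
    hF.totalDerivSnd_baseComp hz hU hQ, hF.totalDerivSnd_psiComp hz hU hQ, Fin.sum_univ_succ,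
    hF.time z hz, Complex.ofReal_zero, zero_mul, mul_zero, zero_add, ← two_mul, Finset.mul_sum]

theorem criterion_eq (S : Base n × ℝ → ℂ) {p : Fin (n + 1) → ℂ}
    {q : Fin (n + 1) → Fin (n + 1) → ℂ} (hq : ∀ μ ν, q μ ν = q ν μ)
    (he : Complex.I * p 0 + ∑ a : Fin n, q a.succ a.succ + nonlinearTerm S z = 0) :
    criterion S Q z p q = zeroOrderPart S Q z + ∑ a : Fin n,
      (p a.succ * (2 * dirDeriv (baseDir a.succ) (psiCoeff Q) z -
          Complex.I * ((dirDeriv (baseDir 0) (baseComp Q a.succ) z : ℝ) : ℂ)) +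
        p a.succ ^ 2 * dirDeriv (psiDir 1) (psiCoeff Q) z) := by
  have hkill := hF.killing_sum_mul hz fun a b => hq (Fin.succ a) (Fin.succ b)
  have hsum : ∑ a : Fin n, (p a.succ * (2 * dirDeriv (baseDir a.succ) (psiCoeff Q) z -
      Complex.I * ((dirDeriv (baseDir 0) (baseComp Q a.succ) z : ℝ) : ℂ))) =
      2 * ∑ a : Fin n, p a.succ * dirDeriv (baseDir a.succ) (psiCoeff Q) z -
        Complex.I * ∑ a : Fin n,
          ((dirDeriv (baseDir 0) (baseComp Q a.succ) z : ℝ) : ℂ) * p a.succ := by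
    rw [Finset.mul_sum, Finset.mul_sum, ← Finset.sum_sub_distrib]
    exact Finset.sum_congr rfl fun a _ => by ring
  simp only [criterion, zeroOrderPart, schrodingerOp, hF.prolongFst_zero hz,
    hF.prolongSnd_succ hz hU hQ, Finset.sum_add_distrib, Finset.sum_sub_distrib,
    ← Finset.mul_sum, ← Finset.sum_mul, hsum]
  linear_combination -hkill + (psiCoeff Q z -
    ((dirDeriv (baseDir 0) (baseComp Q 0) z : ℝ) : ℂ)) * he

end SecondDerivatives

end FirstOrderEqs

/-- The determining equations that do not involve `S`: besides the first-order ones, `η` is affine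
in `ψ`, and its phase coefficient is tied to the velocity `ξ_t`. -/
structure DeterminingEqs (U : Set (Base n × ℂ)) (Q : VField n) : Prop extends
    FirstOrderEqs U Q where
  affine : ∀ z ∈ U, dirDeriv (psiDir 1) (psiCoeff Q) z = 0
  phase : ∀ z ∈ U, ∀ a : Fin n, 2 * dirDeriv (baseDir a.succ) (psiCoeff Q) z =
    Complex.I * ((dirDeriv (baseDir 0) (baseComp Q a.succ) z : ℝ) : ℂ)

theorem DeterminingEqs.of_criterionAt (hn : 1 ≤ n) (hU : IsOpen U) (hQ : ContDiffOn ℝ ∞ Q U)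
    (h : ∀ z ∈ U, CriterionAt S Q z) :
    DeterminingEqs U Q ∧ ∀ z ∈ U, zeroOrderPart S Q z = 0 := by
  have hF := firstOrderEqs_of_criterionAt hn hU h
  have hquad (z) (hz : z ∈ U) (a : Fin n) (s : ℂ) : zeroOrderPart S Q z +
      (s * (2 * dirDeriv (baseDir a.succ) (psiCoeff Q) z -
          Complex.I * ((dirDeriv (baseDir 0) (baseComp Q a.succ) z : ℝ) : ℂ)) +
        s ^ 2 * dirDeriv (psiDir 1) (psiCoeff Q) z) = 0 := by
    have hcrit := (h z hz).criterion_cons_zero (Pi.single a s)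
    rw [hF.criterion_eq hz hU hQ S (fun _ _ => rfl)
      (by simpa using I_mul_freeTimeDeriv z)] at hcrit
    simp only [Fin.cons_succ] at hcrit
    rwa [Finset.sum_eq_single a (fun b _ hb => by simp [hb]) (by simp), Pi.single_eq_same] at hcrit
  have hzero (z) (hz : z ∈ U) : zeroOrderPart S Q z = 0 := by
    simpa using hquad z hz ⟨0, hn⟩ 0
  refine ⟨⟨hF, fun z hz => ?_, fun z hz a => ?_⟩, hzero⟩
  · linear_combination (1 / 2 : ℂ) * (hquad z hz ⟨0, hn⟩ 1 + hquad z hz ⟨0, hn⟩ (-1)) -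
      hzero z hz
  · linear_combination (1 / 2 : ℂ) * (hquad z hz a 1 - hquad z hz a (-1))

theorem forall_criterionAt_iff_determiningEqs (hn : 1 ≤ n) (hU : IsOpen U)
    (hQ : ContDiffOn ℝ ∞ Q U) :
    (∀ z ∈ U, CriterionAt S Q z) ↔ DeterminingEqs U Q ∧ ∀ z ∈ U, zeroOrderPart S Q z = 0 := by
  refine ⟨DeterminingEqs.of_criterionAt hn hU hQ, fun ⟨hF, hzero⟩ z hz p q hq he => ?_⟩
  rw [hF.criterion_eq hz hU hQ S hq he, hzero z hz]
  simp [hF.affine z hz, hF.phase z hz]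

namespace DeterminingEqs

variable (hE : DeterminingEqs U Q) {z : Base n × ℂ} (hz : z ∈ U)
include hE hz

theorem two_mul_dirDeriv_baseComp_succ_self (a : Fin n) :
    2 * dirDeriv (baseDir a.succ) (baseComp Q a.succ) z =
      dirDeriv (baseDir 0) (baseComp Q 0) z := by
  simpa [two_mul] using hE.killing z hz a a

variable (hU : IsOpen U) (hQ : ContDiffOn ℝ ∞ Q U)
include hU hQ

theorem two_mul_dirDeriv_dirDeriv_psiCoeff (u : Base n × ℂ) (a : Fin n) :
    2 * dirDeriv u (dirDeriv (baseDir a.succ) (psiCoeff Q)) z =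
      Complex.I * ((dirDeriv u (dirDeriv (baseDir 0) (baseComp Q a.succ)) z : ℝ) : ℂ) := by
  have hη := differentiableAt_of_contDiffOn hU
    (contDiffOn_dirDeriv hU (contDiffOn_psiCoeff hU hQ) (baseDir a.succ)) hz
  have hξ := differentiableAt_of_contDiffOn hU
    (contDiffOn_dirDeriv hU (contDiffOn_baseComp hQ a.succ) (baseDir 0)) hz
  rw [← dirDeriv_ofReal u hξ]
  exact (dirDeriv_clm_comp u (ContinuousLinearMap.mul ℝ ℂ 2) hη).symm.trans
    ((dirDeriv_congr hU (fun z hz => hE.phase z hz a) u hz).trans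
      (dirDeriv_clm_comp u (ContinuousLinearMap.mul ℝ ℂ Complex.I)
        (Complex.ofRealCLM.differentiableAt.comp z hξ)))

theorem dirDeriv_time_dirDeriv_baseComp_symm (a b : Fin n) :
    dirDeriv (baseDir 0) (dirDeriv (baseDir a.succ) (baseComp Q b.succ)) z =
      dirDeriv (baseDir 0) (dirDeriv (baseDir b.succ) (baseComp Q a.succ)) z := by
  have hI : Complex.I *
      ((dirDeriv (baseDir a.succ) (dirDeriv (baseDir 0) (baseComp Q b.succ)) z : ℝ) : ℂ) =
      Complex.I *
        ((dirDeriv (baseDir b.succ) (dirDeriv (baseDir 0) (baseComp Q a.succ)) z : ℝ) : ℂ) := by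
    rw [← hE.two_mul_dirDeriv_dirDeriv_psiCoeff hz hU hQ,
      ← hE.two_mul_dirDeriv_dirDeriv_psiCoeff hz hU hQ,
      dirDeriv_comm hU (contDiffOn_psiCoeff hU hQ) hz]
  rw [dirDeriv_comm hU (contDiffOn_baseComp hQ b.succ) hz,
    dirDeriv_comm hU (contDiffOn_baseComp hQ a.succ) hz]
  exact_mod_cast mul_left_cancel₀ Complex.I_ne_zero hI

theorem sum_dirDeriv_dirDeriv_psiCoeff :
    ∑ a : Fin n, dirDeriv (baseDir a.succ) (dirDeriv (baseDir a.succ) (psiCoeff Q)) z =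
      Complex.I * (n / 4) *
        ((dirDeriv (baseDir 0) (dirDeriv (baseDir 0) (baseComp Q 0)) z : ℝ) : ℂ) := by
  have hterm (a : Fin n) :
      dirDeriv (baseDir a.succ) (dirDeriv (baseDir a.succ) (psiCoeff Q)) z = Complex.I / 4 *
        ((dirDeriv (baseDir 0) (dirDeriv (baseDir 0) (baseComp Q 0)) z : ℝ) : ℂ) := by
    have hξ := differentiableAt_of_contDiffOn hU
      (contDiffOn_dirDeriv hU (contDiffOn_baseComp hQ a.succ) (baseDir a.succ)) hz
    have hdiag := (dirDeriv_clm_comp (baseDir 0) (ContinuousLinearMap.mul ℝ ℝ 2) hξ).symm.trans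
      (dirDeriv_congr hU (fun z hz => hE.two_mul_dirDeriv_baseComp_succ_self hz a) _ hz)
    have hη := hE.two_mul_dirDeriv_dirDeriv_psiCoeff hz hU hQ (baseDir a.succ) a
    rw [dirDeriv_comm hU (contDiffOn_baseComp hQ _) hz] at hη
    rw [← hdiag, ContinuousLinearMap.mul_apply', Complex.ofReal_mul, Complex.ofReal_ofNat]
    linear_combination hη / 2
  simp only [hterm, Finset.sum_const, Finset.card_univ, Fintype.card_fin, nsmul_eq_mul]
  ring

end DeterminingEqs

end DeterminingEquations

section ZeroOrder

variable {n : ℕ} {U : Set (Base n × ℂ)} {D : Set (Base n × ℝ)} {S : Base n × ℝ → ℂ} {Q : VField n}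

theorem hasFDerivAt_norm {V : Type*} [NormedAddCommGroup V] [InnerProductSpace ℝ V] {x : V}
    (hx : x ≠ 0) : HasFDerivAt (fun y : V => ‖y‖) (‖x‖⁻¹ • innerSL ℝ x) x := by
  have hsq := (hasStrictFDerivAt_norm_sq x).hasFDerivAt.sqrt (by simpa using hx)
  simp only [Real.sqrt_sq (norm_nonneg _)] at hsq
  convert hsq using 1
  ext y
  simp only [smul_apply, coe_innerSL_apply, smul_eq_mul, one_div, mul_inv_rev, nsmul_eq_mul,
    Nat.cast_ofNat]
  ring

theorem inner_div_norm_mul_self (w g : ℂ) :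
    ((inner ℝ w g / ‖w‖ : ℝ) : ℂ) * w =
      (‖w‖ / 2 : ℂ) * g + (starRingEnd ℂ) g / (2 * ‖w‖) * w ^ 2 := by
  rcases eq_or_ne w 0 with rfl | hw
  · simp
  have hnorm : (‖w‖ : ℂ) ≠ 0 := by simpa using hw
  have hinner : ((inner ℝ w g : ℝ) : ℂ) =
      ((starRingEnd ℂ) w * g + (starRingEnd ℂ) g * w) / 2 := by
    rw [Complex.inner, Complex.re_eq_add_conj]
    simp [mul_comm]
  have hsq : (starRingEnd ℂ) w * w = (‖w‖ : ℂ) ^ 2 := Complex.conj_mul' w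
  rw [Complex.ofReal_div, hinner]
  field_simp
  linear_combination g * hsq

theorem dirDeriv_nonlinearTerm (hD : IsAdmissibleDomain D) (hS : ContDiffOn ℝ ∞ S D)
    {z : Base n × ℂ} (hz : z ∈ pointSpace D) (v : Base n × ℂ) :
    dirDeriv v (nonlinearTerm S) z =
      fderiv ℝ S (z.1, ‖z.2‖) (v.1, inner ℝ z.2 v.2 / ‖z.2‖) * z.2 + S (z.1, ‖z.2‖) * v.2 := by
  have hnorm : HasFDerivAt (fun z : Base n × ℂ => (z.1, ‖z.2‖)) _ z :=
    hasFDerivAt_fst.prodMk ((hasFDerivAt_norm (hD.snd_ne_zero hz)).comp z hasFDerivAt_snd)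
  have hcomp := (differentiableAt_of_contDiffOn hD.isOpen hS hz).hasFDerivAt.comp z hnorm
  refine (DFunLike.congr_fun (hcomp.mul hasFDerivAt_snd).fderiv v).trans ?_
  simp only [Function.comp_apply, ContinuousLinearMap.smul_comp, add_apply, smul_apply,
    ContinuousLinearMap.coe_snd', smul_eq_mul, ContinuousLinearMap.comp_apply,
    ContinuousLinearMap.prod_apply, ContinuousLinearMap.coe_fst', coe_innerSL_apply,
    div_eq_inv_mul]
  ring

theorem eq_zero_of_quadratic_eq_zero_on_circle {a b d : ℂ}
    (h : ∀ c : ℂ, ‖c‖ = 1 → a * c + b + d * c ^ 2 = 0) : a = 0 ∧ d = 0 := by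
  have hone := h 1 (by simp)
  have hneg := h (-1) (by simp)
  have hI := h Complex.I (by simp)
  have ha : a = 0 := by linear_combination (1 / 2 : ℂ) * (hone - hneg)
  exact ⟨ha, by linear_combination (1 / 2 : ℂ) * (hone - hI + (Complex.I - 1) * ha +
    d * Complex.I_mul_I)⟩

/-- The inhomogeneous part `η - η_ψ ψ` of the component `η`. -/
def inhomPart (Q : VField n) (z : Base n × ℂ) : ℂ := psiComp Q z - psiCoeff Q z * z.2

theorem psiComp_eq (Q : VField n) :
    psiComp Q = fun z => psiCoeff Q z * z.2 + inhomPart Q z := by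
  funext z
  rw [inhomPart, add_sub_cancel]

theorem contDiffOn_inhomPart (hU : IsOpen U) (hQ : ContDiffOn ℝ ∞ Q U) :
    ContDiffOn ℝ ∞ (inhomPart Q) U :=
  (contDiffOn_psiComp hQ).sub ((contDiffOn_psiCoeff hU hQ).mul contDiff_snd.contDiffOn)

namespace DeterminingEqs

variable (hE : DeterminingEqs U Q) (hU : IsOpen U) (hQ : ContDiffOn ℝ ∞ Q U)
include hE hU hQ

theorem isPsiIndependent_psiCoeff : IsPsiIndependent U (psiCoeff Q) := fun z hz w => by
  rw [hE.dirDeriv_psiDir_psiCoeff hz hU hQ, hE.affine z hz, mul_zero]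

theorem isPsiIndependent_inhomPart : IsPsiIndependent U (inhomPart Q) := fun z hz w => by
  have hη := differentiableAt_of_contDiffOn hU (contDiffOn_psiComp hQ) hz
  have hcoeff := differentiableAt_of_contDiffOn hU (contDiffOn_psiCoeff hU hQ) hz
  refine (dirDeriv_sub _ hη (hcoeff.fun_mul differentiableAt_snd)).trans ?_
  have hsnd : dirDeriv (psiDir w) (fun z : Base n × ℂ => z.2) z = w :=
    dirDeriv_clm _ (ContinuousLinearMap.snd ℝ (Base n) ℂ)
  rw [dirDeriv_mul _ hcoeff differentiableAt_snd, hsnd, hE.holomorphic z hz,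
    hE.isPsiIndependent_psiCoeff hU hQ z hz]
  ring

end DeterminingEqs

theorem dirDeriv_baseDir_mul_snd_add {f g : Base n × ℂ → ℂ} {z : Base n × ℂ}
    (hf : DifferentiableAt ℝ f z) (hg : DifferentiableAt ℝ g z) (μ : Fin (n + 1)) :
    dirDeriv (baseDir μ) (fun z => f z * z.2 + g z) z =
      dirDeriv (baseDir μ) f z * z.2 + dirDeriv (baseDir μ) g z := by
  have hsnd : dirDeriv (baseDir μ) (fun z : Base n × ℂ => z.2) z = 0 :=
    dirDeriv_clm _ (ContinuousLinearMap.snd ℝ (Base n) ℂ)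
  rw [dirDeriv_add _ (hf.fun_mul differentiableAt_snd) hg, dirDeriv_mul _ hf differentiableAt_snd,
    hsnd, mul_zero, add_zero]

theorem schrodingerOp_mul_snd_add {f g : Base n × ℂ → ℂ} (hU : IsOpen U)
    (hf : ContDiffOn ℝ ∞ f U) (hg : ContDiffOn ℝ ∞ g U) {z : Base n × ℂ} (hz : z ∈ U) :
    schrodingerOp (fun z => f z * z.2 + g z) z = schrodingerOp f z * z.2 + schrodingerOp g z := by
  have hfst (μ : Fin (n + 1)) {y : Base n × ℂ} (hy : y ∈ U) :=
    dirDeriv_baseDir_mul_snd_add (differentiableAt_of_contDiffOn hU hf hy)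
      (differentiableAt_of_contDiffOn hU hg hy) μ
  have hsnd (μ : Fin (n + 1)) :
      dirDeriv (baseDir μ) (dirDeriv (baseDir μ) fun z => f z * z.2 + g z) z =
        dirDeriv (baseDir μ) (dirDeriv (baseDir μ) f) z * z.2 +
          dirDeriv (baseDir μ) (dirDeriv (baseDir μ) g) z :=
    (dirDeriv_congr hU (fun _ => hfst μ) _ hz).trans <| dirDeriv_baseDir_mul_snd_add
      (differentiableAt_of_contDiffOn hU (contDiffOn_dirDeriv hU hf _) hz)
      (differentiableAt_of_contDiffOn hU (contDiffOn_dirDeriv hU hg _) hz) μ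
  simp only [schrodingerOp, hfst 0 hz, hsnd, Finset.sum_add_distrib, ← Finset.sum_mul]
  ring

theorem schrodingerOp_eq_zero {f : Base n × ℂ → ℂ} (hU : IsOpen U) (hf : ∀ z ∈ U, f z = 0)
    {z : Base n × ℂ} (hz : z ∈ U) : schrodingerOp f z = 0 := by
  have hfst (v) {y} (hy : y ∈ U) : dirDeriv v f y = 0 := dirDeriv_eq_zero_of_eqOn_const hU hf hy v
  simp only [schrodingerOp, hfst _ hz,
    dirDeriv_eq_zero_of_eqOn_const hU (fun _ hy => hfst _ hy) hz, Finset.sum_const_zero, mul_zero,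
    add_zero]

/-- The coefficient of `ψ` in `zeroOrderPart`. -/
def zeroOrderLinear (S : Base n × ℝ → ℂ) (Q : VField n) (z : Base n × ℂ) : ℂ :=
  schrodingerOp (psiCoeff Q) z +
    ((dirDeriv (baseDir 0) (baseComp Q 0) z : ℝ) : ℂ) * S (z.1, ‖z.2‖) +
    fderiv ℝ S (z.1, ‖z.2‖) ((Q z).1, ‖z.2‖ * (psiCoeff Q z).re)

/-- The part of `zeroOrderPart` that does not depend on the phase of `ψ`. -/
def zeroOrderConst (S : Base n × ℝ → ℂ) (Q : VField n) (z : Base n × ℂ) : ℂ :=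
  schrodingerOp (inhomPart Q) z +
    S (z.1, ‖z.2‖) * inhomPart Q z +
    ‖z.2‖ / 2 * dRho S (z.1, ‖z.2‖) * inhomPart Q z

theorem zeroOrderPart_eq (hD : IsAdmissibleDomain D) (hS : ContDiffOn ℝ ∞ S D)
    (hQ : ContDiffOn ℝ ∞ Q (pointSpace D)) {z : Base n × ℂ} (hz : z ∈ pointSpace D) :
    zeroOrderPart S Q z = zeroOrderLinear S Q z * z.2 + zeroOrderConst S Q z +
      dRho S (z.1, ‖z.2‖) * (starRingEnd ℂ) (inhomPart Q z) / (2 * ‖z.2‖) * z.2 ^ 2 := by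
  have hU := hD.isOpen_pointSpace
  have hρ : ‖z.2‖ ≠ 0 := norm_ne_zero_iff.2 (hD.snd_ne_zero hz)
  have hη : (Q z).2 = psiCoeff Q z * z.2 + inhomPart Q z := congrFun (psiComp_eq Q) z
  have hinner : inner ℝ z.2 (Q z).2 / ‖z.2‖ =
      ‖z.2‖ * (psiCoeff Q z).re + inner ℝ z.2 (inhomPart Q z) / ‖z.2‖ := by
    have hmul : inner ℝ z.2 (psiCoeff Q z * z.2) = ‖z.2‖ ^ 2 * (psiCoeff Q z).re := by
      rw [← Complex.normSq_eq_norm_sq, Complex.normSq_apply, Complex.inner]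
      simp only [Complex.mul_re, Complex.conj_re, Complex.mul_im, Complex.conj_im, mul_neg,
        sub_neg_eq_add]
      ring
    rw [hη, inner_add_right, hmul]
    field_simp
  have hfderiv : fderiv ℝ S (z.1, ‖z.2‖) ((Q z).1, inner ℝ z.2 (Q z).2 / ‖z.2‖) =
      fderiv ℝ S (z.1, ‖z.2‖) ((Q z).1, ‖z.2‖ * (psiCoeff Q z).re) +
        ((inner ℝ z.2 (inhomPart Q z) / ‖z.2‖ : ℝ) : ℂ) * dRho S (z.1, ‖z.2‖) := by
    rw [dRho, ← Complex.real_smul, ← map_smul, ← map_add, hinner]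
    simp
  rw [zeroOrderPart, dirDeriv_nonlinearTerm hD hS hz, hfderiv, psiComp_eq Q,
    schrodingerOp_mul_snd_add hU (contDiffOn_psiCoeff hU hQ) (contDiffOn_inhomPart hU hQ) hz,
    zeroOrderLinear, zeroOrderConst, nonlinearTerm, hη]
  linear_combination dRho S (z.1, ‖z.2‖) * inner_div_norm_mul_self z.2 (inhomPart Q z)

section Rotation

variable (hD : IsAdmissibleDomain D) {z : Base n × ℂ} (hz : z ∈ pointSpace D) {c : ℂ} (hc : ‖c‖ = 1)
include hD hz hc

theorem IsPsiIndependent.dirDeriv_rotation {F : Type*} [NormedAddCommGroup F] [NormedSpace ℝ F]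
    {f : Base n × ℂ → F} (h : IsPsiIndependent (pointSpace D) f)
    (hf : ContDiffOn ℝ ∞ f (pointSpace D)) (v : Base n × ℂ) :
    dirDeriv v f (z.1, c * z.2) = dirDeriv v f z :=
  (isPsiIndependent_dirDeriv h hD.isOpen_pointSpace hf v).apply_rotation hD
    ((contDiffOn_dirDeriv hD.isOpen_pointSpace hf v).differentiableOn (by simp)) hz hc

theorem IsPsiIndependent.schrodingerOp_rotation {f : Base n × ℂ → ℂ}
    (h : IsPsiIndependent (pointSpace D) f) (hf : ContDiffOn ℝ ∞ f (pointSpace D)) :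
    schrodingerOp f (z.1, c * z.2) = schrodingerOp f z := by
  have hU := hD.isOpen_pointSpace
  simp only [schrodingerOp, h.dirDeriv_rotation hD hz hc hf,
    (isPsiIndependent_dirDeriv h hU hf _).dirDeriv_rotation hD hz hc (contDiffOn_dirDeriv hU hf _)]

namespace DeterminingEqs

variable (hE : DeterminingEqs (pointSpace D) Q) (hQ : ContDiffOn ℝ ∞ Q (pointSpace D))
include hE hQ

theorem inhomPart_rotation : inhomPart Q (z.1, c * z.2) = inhomPart Q z :=
  (hE.isPsiIndependent_inhomPart hD.isOpen_pointSpace hQ).apply_rotation hD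
    ((contDiffOn_inhomPart hD.isOpen_pointSpace hQ).differentiableOn (by simp)) hz hc

theorem zeroOrderLinear_rotation (S : Base n × ℝ → ℂ) :
    zeroOrderLinear S Q (z.1, c * z.2) = zeroOrderLinear S Q z := by
  have hcoeff := contDiffOn_psiCoeff hD.isOpen_pointSpace hQ
  have hcoeffψ := hE.isPsiIndependent_psiCoeff hD.isOpen_pointSpace hQ
  have hbase : (Q (z.1, c * z.2)).1 = (Q z).1 := funext fun l =>
    (hE.base_psi l).apply_rotation hD ((contDiffOn_baseComp hQ l).differentiableOn (by simp)) hz hc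
  simp only [zeroOrderLinear, hcoeffψ.schrodingerOp_rotation hD hz hc hcoeff,
    (hE.base_psi 0).dirDeriv_rotation hD hz hc (contDiffOn_baseComp hQ 0), hbase,
    hcoeffψ.apply_rotation hD (hcoeff.differentiableOn (by simp)) hz hc, norm_mul, hc, one_mul]

theorem zeroOrderConst_rotation (S : Base n × ℝ → ℂ) :
    zeroOrderConst S Q (z.1, c * z.2) = zeroOrderConst S Q z := by
  have hU := hD.isOpen_pointSpace
  simp only [zeroOrderConst, hE.inhomPart_rotation hD hz hc hQ, norm_mul, hc, one_mul,
    (hE.isPsiIndependent_inhomPart hU hQ).schrodingerOp_rotation hD hz hc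
      (contDiffOn_inhomPart hU hQ)]

end DeterminingEqs

end Rotation

theorem DeterminingEqs.zeroOrderLinear_eq_zero_and_inhomPart_eq_zero
    (hE : DeterminingEqs (pointSpace D) Q) (hD : IsAdmissibleDomain D)
    (hS : ContDiffOn ℝ ∞ S D) (hQ : ContDiffOn ℝ ∞ Q (pointSpace D))
    (h : ∀ z ∈ pointSpace D, zeroOrderPart S Q z = 0) {z : Base n × ℂ} (hz : z ∈ pointSpace D) :
    zeroOrderLinear S Q z = 0 ∧ (dRho S (z.1, ‖z.2‖) ≠ 0 → inhomPart Q z = 0) := by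
  have hψ := hD.snd_ne_zero hz
  -- Rotating `ψ` by `c` turns the zero-order equation into a quadratic polynomial in `c`.
  obtain ⟨hlin, hquad⟩ := eq_zero_of_quadratic_eq_zero_on_circle (a := zeroOrderLinear S Q z * z.2)
    (b := zeroOrderConst S Q z)
    (d := dRho S (z.1, ‖z.2‖) * (starRingEnd ℂ) (inhomPart Q z) / (2 * ‖z.2‖) * z.2 ^ 2)
    fun c hc => by
      have hzc := zeroOrderPart_eq hD hS hQ (rotation_mem_pointSpace hz hc)
      rw [h _ (rotation_mem_pointSpace hz hc), hE.zeroOrderLinear_rotation hD hz hc hQ,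
        hE.zeroOrderConst_rotation hD hz hc hQ, hE.inhomPart_rotation hD hz hc hQ, norm_mul, hc,
        one_mul] at hzc
      linear_combination -hzc
  exact ⟨by simpa [hψ] using hlin, fun hρ => by simpa [hψ, hρ] using hquad⟩

theorem IsClassS.pointSpace_subset_closure (hS : IsClassS D S) (hD : IsAdmissibleDomain D) :
    pointSpace D ⊆ closure {z ∈ pointSpace D | dRho S (z.1, ‖z.2‖) ≠ 0} := fun z hz => by
  let lift : Base n × ℝ → Base n × ℂ := fun p => (p.1, (p.2 / ‖z.2‖ : ℝ) * z.2)
  have hρ : ‖z.2‖ ≠ 0 := norm_ne_zero_iff.2 (hD.snd_ne_zero hz)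
  have hlift : lift (z.1, ‖z.2‖) = z := by
    simp only [lift, div_self hρ, Complex.ofReal_one, one_mul]
  rw [← hlift]
  refine map_mem_closure (by fun_prop) (hS.dRho_ne_zero hz) fun p hp => ?_
  have hnorm : ‖(lift p).2‖ = p.2 := by
    simp [lift, abs_of_pos (hD.rho_pos p hp.1), hρ]
  simpa only [Set.mem_ofPred_eq, pointSpace, hnorm] using hp

theorem DeterminingEqs.inhomPart_eq_zero (hE : DeterminingEqs (pointSpace D) Q)
    (hD : IsAdmissibleDomain D) (hS : IsClassS D S) (hQ : ContDiffOn ℝ ∞ Q (pointSpace D))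
    (h : ∀ z ∈ pointSpace D, zeroOrderPart S Q z = 0) : ∀ z ∈ pointSpace D, inhomPart Q z = 0 :=
  Set.EqOn.of_subset_closure
    (fun _ hz => (hE.zeroOrderLinear_eq_zero_and_inhomPart_eq_zero hD hS.smooth hQ h hz.1).2 hz.2)
    (contDiffOn_inhomPart hD.isOpen_pointSpace hQ).continuousOn continuousOn_const
    (fun _ hz => hz.1) (hS.pointSpace_subset_closure hD)

theorem mem_maximalLieInvarianceAlgebra_iff_zeroOrderLinear (hn : 1 ≤ n)
    (hD : IsAdmissibleDomain D) (hS : IsClassS D S) :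
    Q ∈ maximalLieInvarianceAlgebra D S ↔
      (ContDiffOn ℝ ∞ Q (pointSpace D) ∧ DeterminingEqs (pointSpace D) Q ∧
        ∀ z ∈ pointSpace D, inhomPart Q z = 0) ∧
      ∀ z ∈ pointSpace D, zeroOrderLinear S Q z = 0 := by
  rw [mem_maximalLieInvarianceAlgebra_iff_criterionAt hD hS.smooth, and_assoc]
  refine and_congr_right fun hQ => ?_
  rw [forall_criterionAt_iff_determiningEqs hn hD.isOpen_pointSpace hQ, and_assoc]
  refine and_congr_right fun hE => ⟨fun h => ⟨hE.inhomPart_eq_zero hD hS hQ h, fun z hz =>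
    (hE.zeroOrderLinear_eq_zero_and_inhomPart_eq_zero hD hS.smooth hQ h hz).1⟩,
    fun ⟨hinhom, hlin⟩ z hz => ?_⟩
  rw [zeroOrderPart_eq hD hS.smooth hQ hz, zeroOrderConst, hlin z hz,
    schrodingerOp_eq_zero hD.isOpen_pointSpace hinhom hz, hinhom z hz]
  simp

end ZeroOrder

section NormalForm

variable {n : ℕ} {τ : ℝ → ℝ} {κ : Matrix (Fin n) (Fin n) ℝ} {χ : Fin n → ℝ → ℝ} {σ ζ : ℝ → ℝ}
  {z : Base n × ℂ}

/-- The component `ξ^a` of `generalField`. -/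
def spaceComp (τ : ℝ → ℝ) (κ : Matrix (Fin n) (Fin n) ℝ) (χ : Fin n → ℝ → ℝ) (a : Fin n)
    (z : Base n × ℂ) : ℝ :=
  1 / 2 * deriv τ (z.1 0) * z.1 a.succ + ∑ b, κ a b * z.1 b.succ + χ a (z.1 0)

/-- The coefficient of `M` in `generalField`. -/
def phaseComp (τ : ℝ → ℝ) (χ : Fin n → ℝ → ℝ) (σ : ℝ → ℝ) (z : Base n × ℂ) : ℝ :=
  1 / 8 * iteratedDeriv 2 τ (z.1 0) * ∑ a : Fin n, z.1 a.succ * z.1 a.succ +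
    1 / 2 * ∑ a, deriv (χ a) (z.1 0) * z.1 a.succ + σ (z.1 0)

/-- The factor of `ψ` in the component `η` of `generalField`. -/
def psiFactor (τ : ℝ → ℝ) (χ : Fin n → ℝ → ℝ) (σ ζ : ℝ → ℝ) (z : Base n × ℂ) : ℂ :=
  Complex.I * phaseComp τ χ σ z + ζ (z.1 0)

theorem sum_Ioi_mul_sub_of_skew (hκ : κ.transpose = -κ) (x : Fin n → ℝ) (c : Fin n) :
    ∑ a, ∑ b ∈ Finset.Ioi a,
        κ a b * ((Pi.single b (x a) : Fin n → ℝ) c - (Pi.single a (x b) : Fin n → ℝ) c) =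
      -∑ b, κ c b * x b := by
  have hskew (a b) : κ b a = -κ a b := congrFun₂ hκ a b
  let J (a b : Fin n) : ℝ := (Pi.single b (x a) : Fin n → ℝ) c - (Pi.single a (x b) : Fin n → ℝ) c
  have hterm (a b : Fin n) : (if a < b then κ a b * J a b else 0) =
      (if c = b then if a < c then κ a c * x a else 0 else 0) -
        if c = a then if c < b then κ c b * x b else 0 else 0 := by
    simp only [J, Pi.single_apply]
    split_ifs <;> grind
  have hIoi (a : Fin n) :
      ∑ b ∈ Finset.Ioi a, κ a b * J a b = ∑ b, if a < b then κ a b * J a b else 0 := by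
    rw [← Finset.sum_filter, Finset.filter_lt_eq_Ioi]
  refine (Finset.sum_congr rfl fun a _ => hIoi a).trans ?_
  simp only [hterm, Finset.sum_sub_distrib, Finset.sum_ite_eq, Finset.mem_univ, if_true,
    Finset.sum_ite_irrel, Finset.sum_const_zero]
  rw [← Finset.sum_sub_distrib, ← Finset.sum_neg_distrib]
  refine Finset.sum_congr rfl fun b _ => ?_
  rcases lt_trichotomy b c with hbc | rfl | hbc
  · simp [hbc, hbc.not_gt, hskew c b]
  · simp [self_eq_neg.1 (hskew b b)]
  · simp [hbc, hbc.not_gt]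

theorem generalField_eq (hκ : κ.transpose = -κ) :
    generalField τ κ χ σ ζ z = (Fin.cons (τ (z.1 0)) fun a => spaceComp τ κ χ a z,
      psiFactor τ χ σ ζ z * z.2) := by
  refine Prod.ext (funext fun l => ?_) ?_
  · refine Fin.cases ?_ (fun c => ?_) l
    · simp [generalField, fieldD, fieldP, fieldM, fieldI, fieldJ, Prod.fst_sum]
    · calc (generalField τ κ χ σ ζ z).1 c.succ
          = 1 / 2 * deriv τ (z.1 0) * z.1 c.succ - ∑ a, ∑ b ∈ Finset.Ioi a,
              κ a b * ((Pi.single b (z.1 a.succ) : Fin n → ℝ) c -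
                (Pi.single a (z.1 b.succ) : Fin n → ℝ) c) + χ c (z.1 0) := by
            simp [generalField, fieldD, fieldP, fieldM, fieldI, fieldJ, Prod.fst_sum,
              Pi.single_apply]
        _ = spaceComp τ κ χ c z := by
            rw [sum_Ioi_mul_sub_of_skew hκ (fun a => z.1 a.succ) c, spaceComp, sub_neg_eq_add]
  · simp only [generalField, fieldD, fieldP, fieldM, fieldI, fieldJ, psiFactor, phaseComp,
      Prod.snd_add, Prod.snd_sub, Prod.snd_sum, Prod.smul_snd, Complex.real_smul, mul_zero,
      Finset.sum_const_zero]
    push_cast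
    ring

section Smoothness

variable {F : Type*} [NormedAddCommGroup F] [NormedSpace ℝ F] {φ : ℝ → F} {T : Set ℝ}

theorem contDiffOn_iteratedDeriv (hT : IsOpen T) (hφ : ContDiffOn ℝ ∞ φ T) (k : ℕ) :
    ContDiffOn ℝ ∞ (iteratedDeriv k φ) T := by
  induction k with
  | zero => rwa [iteratedDeriv_zero]
  | succ k ih =>
    rw [iteratedDeriv_succ]
    exact ih.deriv_of_isOpen hT (by simp)

theorem contDiffOn_deriv (hT : IsOpen T) (hφ : ContDiffOn ℝ ∞ φ T) :
    ContDiffOn ℝ ∞ (deriv φ) T :=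
  hφ.deriv_of_isOpen hT (by simp)

theorem contDiffOn_comp_time (hφ : ContDiffOn ℝ ∞ φ T) :
    ContDiffOn ℝ ∞ (fun z : Base n × ℂ => φ (z.1 0)) (coordCLM n 0 ⁻¹' T) :=
  hφ.comp (coordCLM n 0).contDiff.contDiffOn fun _ => id

variable (hT : IsOpen T) (hτ : ContDiffOn ℝ ∞ τ T) (hχ : ∀ a, ContDiffOn ℝ ∞ (χ a) T)
include hT hτ hχ

theorem contDiffOn_spaceComp (a : Fin n) :
    ContDiffOn ℝ ∞ (spaceComp τ κ χ a) (coordCLM n 0 ⁻¹' T) :=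
  ((((contDiffOn_const.mul (contDiffOn_comp_time (contDiffOn_deriv hT hτ))).mul
    (coordCLM n a.succ).contDiff.contDiffOn)).add
    (ContDiffOn.sum fun b _ =>
      contDiffOn_const.mul (coordCLM n (Fin.succ b)).contDiff.contDiffOn)).add
    (contDiffOn_comp_time (hχ a))

theorem contDiffOn_phaseComp (hσ : ContDiffOn ℝ ∞ σ T) :
    ContDiffOn ℝ ∞ (phaseComp τ χ σ) (coordCLM n 0 ⁻¹' T) := by
  have hcoord (a : Fin n) :
      ContDiffOn ℝ ∞ (fun z : Base n × ℂ => z.1 a.succ) (coordCLM n 0 ⁻¹' T) :=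
    (coordCLM n a.succ).contDiff.contDiffOn
  exact (((contDiffOn_const.mul (contDiffOn_comp_time (contDiffOn_iteratedDeriv hT hτ 2))).mul
    (ContDiffOn.sum fun a _ => (hcoord a).mul (hcoord a))).add
    (contDiffOn_const.mul (ContDiffOn.sum fun a _ =>
      (contDiffOn_comp_time (contDiffOn_deriv hT (hχ a))).mul (hcoord a)))).add
    (contDiffOn_comp_time hσ)

theorem contDiffOn_psiFactor (hσ : ContDiffOn ℝ ∞ σ T) (hζ : ContDiffOn ℝ ∞ ζ T) :
    ContDiffOn ℝ ∞ (psiFactor τ χ σ ζ) (coordCLM n 0 ⁻¹' T) :=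
  (contDiffOn_const.mul (Complex.ofRealCLM.contDiff.comp_contDiffOn
    (contDiffOn_phaseComp hT hτ hχ hσ))).add
    (Complex.ofRealCLM.contDiff.comp_contDiffOn (contDiffOn_comp_time hζ))

end Smoothness

theorem sum_mul_single_succ (f : Fin n → ℝ) (a : Fin n) :
    ∑ b, f b * (Pi.single a.succ 1 : Base n) b.succ = f a := by
  simp [Pi.single_apply]

section Derivatives

variable {T : Set ℝ} (hT : IsOpen T) (hz : z.1 0 ∈ T) (v : Base n × ℂ)
include hT hz

theorem hasFDerivAt_comp_time {F : Type*} [NormedAddCommGroup F] [NormedSpace ℝ F] {φ : ℝ → F}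
    (hφ : ContDiffOn ℝ ∞ φ T) :
    HasFDerivAt (fun y : Base n × ℂ => φ (y.1 0))
      ((coordCLM n 0).smulRight (deriv φ (z.1 0))) z :=
  ((differentiableAt_of_contDiffOn hT hφ hz).hasFDerivAt.comp z
    (coordCLM n 0).hasFDerivAt).congr_fderiv (by ext <;> simp)

theorem dirDeriv_comp_time {F : Type*} [NormedAddCommGroup F] [NormedSpace ℝ F] {φ : ℝ → F}
    (hφ : ContDiffOn ℝ ∞ φ T) :
    dirDeriv v (fun y : Base n × ℂ => φ (y.1 0)) z = v.1 0 • deriv φ (z.1 0) :=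
  DFunLike.congr_fun (hasFDerivAt_comp_time hT hz hφ).fderiv v

variable (hτ : ContDiffOn ℝ ∞ τ T) (hχ : ∀ a, ContDiffOn ℝ ∞ (χ a) T)
include hτ hχ

theorem dirDeriv_spaceComp (a : Fin n) :
    dirDeriv v (spaceComp τ κ χ a) z =
      v.1 0 * (1 / 2 * iteratedDeriv 2 τ (z.1 0) * z.1 a.succ + deriv (χ a) (z.1 0)) +
        1 / 2 * deriv τ (z.1 0) * v.1 a.succ + ∑ b, κ a b * v.1 b.succ := by
  have h := (((hasFDerivAt_comp_time hT hz (contDiffOn_deriv hT hτ)).const_mul (1 / 2)).mul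
    (coordCLM n a.succ).hasFDerivAt).add
    (HasFDerivAt.fun_sum (u := Finset.univ) fun b _ =>
      (coordCLM n (Fin.succ b)).hasFDerivAt.const_mul (κ a b)) |>.add
    (hasFDerivAt_comp_time hT hz (hχ a))
  refine (DFunLike.congr_fun h.fderiv v).trans ?_
  simp only [_root_.add_apply, _root_.smul_apply, _root_.sum_apply, smul_eq_mul, coordCLM_apply,
    ContinuousLinearMap.smulRight_apply, iteratedDeriv_succ, iteratedDeriv_zero]
  ring

variable (hσ : ContDiffOn ℝ ∞ σ T)
include hσ

theorem dirDeriv_phaseComp :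
    dirDeriv v (phaseComp τ χ σ) z =
      v.1 0 * (1 / 8 * iteratedDeriv 3 τ (z.1 0) * ∑ a : Fin n, z.1 a.succ * z.1 a.succ +
        1 / 2 * ∑ a, iteratedDeriv 2 (χ a) (z.1 0) * z.1 a.succ + deriv σ (z.1 0)) +
      ∑ a, (1 / 4 * iteratedDeriv 2 τ (z.1 0) * z.1 a.succ +
        1 / 2 * deriv (χ a) (z.1 0)) * v.1 a.succ := by
  have hcoord (a : Fin n) := (coordCLM n a.succ).hasFDerivAt (x := z)
  have h := (((hasFDerivAt_comp_time hT hz (contDiffOn_iteratedDeriv hT hτ 2)).const_mul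
    (1 / 8)).mul (HasFDerivAt.fun_sum (u := Finset.univ) fun a _ => (hcoord a).mul (hcoord a))).add
    ((HasFDerivAt.fun_sum (u := Finset.univ) fun a _ =>
      (hasFDerivAt_comp_time hT hz (contDiffOn_deriv hT (hχ a))).mul (hcoord a)).const_mul
        (1 / 2)) |>.add (hasFDerivAt_comp_time hT hz hσ)
  refine (DFunLike.congr_fun h.fderiv v).trans ?_
  simp only [_root_.add_apply, _root_.smul_apply, _root_.sum_apply, smul_eq_mul, coordCLM_apply,
    ContinuousLinearMap.smulRight_apply, iteratedDeriv_succ, iteratedDeriv_zero]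
  simp only [Pi.mul_apply, coordCLM_apply, Finset.mul_sum, Finset.sum_mul, add_mul,
    mul_add, ← Finset.sum_add_distrib]
  rw [add_right_comm, ← Finset.sum_add_distrib]
  congr 1
  refine Finset.sum_congr rfl fun a _ => ?_
  ring

theorem dirDeriv_psiFactor (hζ : ContDiffOn ℝ ∞ ζ T) :
    dirDeriv v (psiFactor τ χ σ ζ) z =
      Complex.I * ((dirDeriv v (phaseComp τ χ σ) z : ℝ) : ℂ) +
        ((v.1 0 * deriv ζ (z.1 0) : ℝ) : ℂ) := by
  have hphase := differentiableAt_of_contDiffOn (hT.preimage (coordCLM n 0).continuous)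
    (contDiffOn_phaseComp hT hτ hχ hσ) hz
  have hphase' := Complex.ofRealCLM.differentiableAt.comp z hphase
  have hζ' := (hasFDerivAt_comp_time hT hz hζ).differentiableAt
  rw [← dirDeriv_ofReal v hphase, ← smul_eq_mul (v.1 0), ← dirDeriv_comp_time hT hz v hζ,
    ← dirDeriv_ofReal v hζ']
  exact (dirDeriv_add v (hphase'.const_mul Complex.I)
    (Complex.ofRealCLM.differentiableAt.comp z hζ')).trans
    (congrArg (· + _) (dirDeriv_clm_comp v (ContinuousLinearMap.mul ℝ ℂ Complex.I) hphase'))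

theorem two_mul_dirDeriv_space_psiFactor (hζ : ContDiffOn ℝ ∞ ζ T) (a : Fin n) :
    2 * dirDeriv (baseDir a.succ) (psiFactor τ χ σ ζ) z =
      Complex.I * ((dirDeriv (baseDir 0) (spaceComp τ κ χ a) z : ℝ) : ℂ) := by
  have hphase : dirDeriv (baseDir a.succ) (phaseComp τ χ σ) z =
      1 / 2 * dirDeriv (baseDir 0) (spaceComp τ κ χ a) z := by
    rw [dirDeriv_phaseComp hT hz _ hτ hχ hσ, dirDeriv_spaceComp hT hz _ hτ hχ, sum_mul_single_succ]
    simp only [Pi.single_eq_same, Pi.single_eq_of_ne (Fin.succ_ne_zero _),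
      Pi.single_eq_of_ne (Fin.succ_ne_zero _).symm, mul_zero, Finset.sum_const_zero]
    ring
  rw [dirDeriv_psiFactor hT hz _ hτ hχ hσ hζ, hphase]
  simp only [Pi.single_eq_of_ne (Fin.succ_ne_zero a).symm, zero_mul]
  push_cast
  ring

end Derivatives

end NormalForm

theorem fderiv_eq_sum_dBase_add_dRho {n : ℕ} (S : Base n × ℝ → ℂ) (p v : Base n × ℝ) :
    fderiv ℝ S p v = ∑ μ, (v.1 μ : ℂ) * dBase S μ p + (v.2 : ℂ) * dRho S p := by
  have hv : v = ∑ μ, v.1 μ • ((Pi.single μ 1, 0) : Base n × ℝ) + v.2 • ((0, 1) : Base n × ℝ) := by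
    refine Prod.ext ?_ (by simp [Prod.snd_sum])
    simp [Prod.fst_sum, ← Pi.single_smul, Finset.univ_sum_single]
  conv_lhs => rw [hv]
  simp only [map_add, map_sum, map_smul, Complex.real_smul, dBase, dRho]

/-- `Q` is `D(τ) - ∑_{a<b} κ_ab J_ab + P(χ) + σ M + ζ I` for smooth parameter functions on the time
interval of `D` and a skew-symmetric matrix `κ`, with no condition relating them to `S`. -/
structure HasNormalForm {n : ℕ} (D : Set (Base n × ℝ)) (Q : VField n) (τ : ℝ → ℝ)
    (κ : Matrix (Fin n) (Fin n) ℝ) (χ : Fin n → ℝ → ℝ) (σ ζ : ℝ → ℝ) : Prop where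
  smooth_time : ContDiffOn ℝ ∞ τ (timeSet D)
  smooth_shift : ∀ a, ContDiffOn ℝ ∞ (χ a) (timeSet D)
  smooth_phase : ContDiffOn ℝ ∞ σ (timeSet D)
  smooth_scale : ContDiffOn ℝ ∞ ζ (timeSet D)
  skew : κ.transpose = -κ
  eqOn : Set.EqOn Q (generalField τ κ χ σ ζ) (pointSpace D)

namespace HasNormalForm

variable {n : ℕ} {D : Set (Base n × ℝ)} {S : Base n × ℝ → ℂ} {Q : VField n} {τ : ℝ → ℝ}
  {κ : Matrix (Fin n) (Fin n) ℝ} {χ : Fin n → ℝ → ℝ} {σ ζ : ℝ → ℝ}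
  (hN : HasNormalForm D Q τ κ χ σ ζ)
include hN

theorem apply_eq {z : Base n × ℂ} (hz : z ∈ pointSpace D) :
    Q z = (Fin.cons (τ (z.1 0)) fun a => spaceComp τ κ χ a z, psiFactor τ χ σ ζ z * z.2) := by
  rw [hN.eqOn hz, generalField_eq hN.skew]

theorem baseComp_zero_eqOn : Set.EqOn (baseComp Q 0) (fun z => τ (z.1 0)) (pointSpace D) :=
  fun z hz => by simp only [baseComp, hN.apply_eq hz, Fin.cons_zero]

theorem baseComp_succ_eqOn (a : Fin n) :
    Set.EqOn (baseComp Q a.succ) (spaceComp τ κ χ a) (pointSpace D) :=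
  fun z hz => by simp only [baseComp, hN.apply_eq hz, Fin.cons_succ]

theorem psiComp_eqOn :
    Set.EqOn (psiComp Q) (fun z => psiFactor τ χ σ ζ z * z.2) (pointSpace D) :=
  fun z hz => by rw [psiComp, hN.apply_eq hz]

variable (hD : IsAdmissibleDomain D)
include hD

theorem contDiffOn_psiFactor : ContDiffOn ℝ ∞ (psiFactor τ χ σ ζ) (pointSpace D) :=
  (NLSym.contDiffOn_psiFactor hD.isOpen_timeSet hN.smooth_time hN.smooth_shift hN.smooth_phase
    hN.smooth_scale).mono fun _ => mem_timeSet

theorem contDiffOn : ContDiffOn ℝ ∞ Q (pointSpace D) := by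
  refine ContDiffOn.prodMk (contDiffOn_pi.2 fun l => ?_)
    (((hN.contDiffOn_psiFactor hD).mul contDiff_snd.contDiffOn).congr hN.psiComp_eqOn)
  refine Fin.cases (ContDiffOn.congr ?_ hN.baseComp_zero_eqOn)
    (fun a => ContDiffOn.congr ?_ (hN.baseComp_succ_eqOn a)) l
  · exact (contDiffOn_comp_time hN.smooth_time).mono fun _ => mem_timeSet
  · exact (contDiffOn_spaceComp hD.isOpen_timeSet hN.smooth_time hN.smooth_shift a).mono
      fun _ => mem_timeSet

variable {z : Base n × ℂ} (hz : z ∈ pointSpace D) (v : Base n × ℂ)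
include hz

theorem dirDeriv_baseComp_zero : dirDeriv v (baseComp Q 0) z = v.1 0 * deriv τ (z.1 0) :=
  (dirDeriv_congr hD.isOpen_pointSpace hN.baseComp_zero_eqOn v hz).trans
    (dirDeriv_comp_time hD.isOpen_timeSet (mem_timeSet hz) v hN.smooth_time)

theorem dirDeriv_dirDeriv_time_baseComp_zero :
    dirDeriv v (dirDeriv (baseDir 0) (baseComp Q 0)) z =
      v.1 0 * iteratedDeriv 2 τ (z.1 0) := by
  have hT := hD.isOpen_timeSet
  refine (dirDeriv_congr hD.isOpen_pointSpace (fun y hy => ?_) v hz).trans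
    ((dirDeriv_comp_time hT (mem_timeSet hz) v (contDiffOn_deriv hT hN.smooth_time)).trans ?_)
  · simp [hN.dirDeriv_baseComp_zero hD hy]
  · rw [smul_eq_mul, iteratedDeriv_succ, iteratedDeriv_one]

theorem dirDeriv_baseComp_succ (a : Fin n) :
    dirDeriv v (baseComp Q a.succ) z =
      v.1 0 * (1 / 2 * iteratedDeriv 2 τ (z.1 0) * z.1 a.succ + deriv (χ a) (z.1 0)) +
        1 / 2 * deriv τ (z.1 0) * v.1 a.succ + ∑ b, κ a b * v.1 b.succ :=
  (dirDeriv_congr hD.isOpen_pointSpace (hN.baseComp_succ_eqOn a) v hz).trans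
    (dirDeriv_spaceComp hD.isOpen_timeSet (mem_timeSet hz) v hN.smooth_time hN.smooth_shift a)

theorem dirDeriv_space_baseComp_succ (a b : Fin n) :
    dirDeriv (baseDir b.succ) (baseComp Q a.succ) z =
      κ a b + if a = b then 1 / 2 * deriv τ (z.1 0) else 0 := by
  rw [hN.dirDeriv_baseComp_succ hD hz, sum_mul_single_succ]
  simp [Pi.single_apply, add_comm]

theorem dirDeriv_psiFactor :
    dirDeriv v (psiFactor τ χ σ ζ) z =
      Complex.I * ((v.1 0 * (1 / 8 * iteratedDeriv 3 τ (z.1 0) *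
            ∑ a : Fin n, z.1 a.succ * z.1 a.succ +
          1 / 2 * ∑ a, iteratedDeriv 2 (χ a) (z.1 0) * z.1 a.succ + deriv σ (z.1 0)) +
        ∑ a, (1 / 4 * iteratedDeriv 2 τ (z.1 0) * z.1 a.succ +
          1 / 2 * deriv (χ a) (z.1 0)) * v.1 a.succ : ℝ) : ℂ) +
      ((v.1 0 * deriv ζ (z.1 0) : ℝ) : ℂ) := by
  rw [NLSym.dirDeriv_psiFactor hD.isOpen_timeSet (mem_timeSet hz) v hN.smooth_time hN.smooth_shift
      hN.smooth_phase hN.smooth_scale,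
    dirDeriv_phaseComp hD.isOpen_timeSet (mem_timeSet hz) v hN.smooth_time hN.smooth_shift
      hN.smooth_phase]

theorem dirDeriv_psiDir_psiComp (w : ℂ) :
    dirDeriv (psiDir w) (psiComp Q) z = w * psiFactor τ χ σ ζ z := by
  have hfactor := differentiableAt_of_contDiffOn hD.isOpen_pointSpace
    (hN.contDiffOn_psiFactor hD) hz
  have hsnd : dirDeriv (psiDir w) (Prod.snd : Base n × ℂ → ℂ) z = w :=
    dirDeriv_clm _ (ContinuousLinearMap.snd ℝ (Base n) ℂ)
  refine (dirDeriv_congr hD.isOpen_pointSpace hN.psiComp_eqOn _ hz).trans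
    ((dirDeriv_mul _ hfactor differentiableAt_snd).trans ?_)
  rw [hsnd, hN.dirDeriv_psiFactor hD hz]
  simp [mul_comm]

theorem psiCoeff_eq : psiCoeff Q z = psiFactor τ χ σ ζ z := by
  rw [psiCoeff, hN.dirDeriv_psiDir_psiComp hD hz, one_mul]

theorem dirDeriv_psiCoeff :
    dirDeriv v (psiCoeff Q) z = dirDeriv v (psiFactor τ χ σ ζ) z :=
  dirDeriv_congr hD.isOpen_pointSpace (fun _ hy => hN.psiCoeff_eq hD hy) v hz

theorem inhomPart_eq_zero : inhomPart Q z = 0 := by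
  rw [inhomPart, hN.psiCoeff_eq hD hz, hN.psiComp_eqOn hz, sub_self]

omit hz in
theorem determiningEqs : DeterminingEqs (pointSpace D) Q where
  time z hz a := by simp [hN.dirDeriv_baseComp_zero hD hz]
  base_psi l z hz w := by
    refine Fin.cases ?_ (fun a => ?_) l
    · simp [hN.dirDeriv_baseComp_zero hD hz]
    · simp [hN.dirDeriv_baseComp_succ hD hz]
  killing z hz a b := by
    have hskew : κ b a = -κ a b := congrFun₂ hN.skew a b
    simp only [hN.dirDeriv_space_baseComp_succ hD hz, hN.dirDeriv_baseComp_zero hD hz]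
    rcases eq_or_ne a b with rfl | hab
    · simp only [self_eq_neg.1 hskew, if_true, Pi.single_eq_same]
      ring
    · simp only [hab, hab.symm, hskew, if_false, add_zero, neg_add_cancel]
  holomorphic z hz w := by
    rw [hN.dirDeriv_psiDir_psiComp hD hz, hN.psiCoeff_eq hD hz]
  affine z hz := by simp [hN.dirDeriv_psiCoeff hD hz, hN.dirDeriv_psiFactor hD hz]
  phase z hz a := by
    rw [hN.dirDeriv_psiCoeff hD hz,
      dirDeriv_congr hD.isOpen_pointSpace (hN.baseComp_succ_eqOn a) _ hz]
    exact two_mul_dirDeriv_space_psiFactor hD.isOpen_timeSet (mem_timeSet hz) hN.smooth_time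
      hN.smooth_shift hN.smooth_phase hN.smooth_scale a

omit hz in
theorem zeroOrderLinear_eq_zero_iff (hz : z ∈ pointSpace D) :
    zeroOrderLinear S Q z = 0 ↔ ClassifyingCondition S τ κ χ σ ζ (z.1, ‖z.2‖) := by
  have hschrodinger : schrodingerOp (psiCoeff Q) z =
      -((1 / 8 * iteratedDeriv 3 τ (z.1 0) * ∑ a : Fin n, z.1 a.succ * z.1 a.succ +
          1 / 2 * ∑ a, iteratedDeriv 2 (χ a) (z.1 0) * z.1 a.succ + deriv σ (z.1 0) : ℝ) : ℂ) +
        Complex.I * ((deriv ζ (z.1 0) : ℝ) : ℂ) +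
        Complex.I * (n / 4) * ((iteratedDeriv 2 τ (z.1 0) : ℝ) : ℂ) := by
    rw [schrodingerOp, hN.dirDeriv_psiCoeff hD hz, hN.dirDeriv_psiFactor hD hz,
      (hN.determiningEqs hD).sum_dirDeriv_dirDeriv_psiCoeff hz hD.isOpen_pointSpace
        (hN.contDiffOn hD), hN.dirDeriv_dirDeriv_time_baseComp_zero hD hz]
    simp only [Pi.single_eq_same, one_mul, Pi.single_eq_of_ne (Fin.succ_ne_zero _), mul_zero,
      Finset.sum_const_zero, add_zero, mul_add, ← mul_assoc, Complex.I_mul_I, neg_one_mul]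
  have hre : (psiCoeff Q z).re = ζ (z.1 0) := by simp [hN.psiCoeff_eq hD hz, psiFactor]
  rw [zeroOrderLinear, hschrodinger, hN.dirDeriv_baseComp_zero hD hz, fderiv_eq_sum_dBase_add_dRho,
    hre, hN.apply_eq hz, Fin.sum_univ_succ, ClassifyingCondition]
  simp only [Fin.cons_zero, Fin.cons_succ, spaceComp, Pi.single_eq_same, one_mul]
  push_cast
  constructor <;> intro h <;> linear_combination h

end HasNormalForm

namespace DeterminingEqs

variable {n : ℕ} {D : Set (Base n × ℝ)} {Q : VField n} {τ : ℝ → ℝ}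
  {κ : Matrix (Fin n) (Fin n) ℝ} {χ : Fin n → ℝ → ℝ} (hE : DeterminingEqs (pointSpace D) Q)
  (hD : IsAdmissibleDomain D) (hQ : ContDiffOn ℝ ∞ Q (pointSpace D))
include hE hD hQ

theorem exists_baseComp_zero_eqOn :
    ∃ τ : ℝ → ℝ, ContDiffOn ℝ ∞ τ (timeSet D) ∧
      Set.EqOn (baseComp Q 0) (fun z => τ (z.1 0)) (pointSpace D) :=
  hD.exists_eq_comp_time (contDiffOn_baseComp hQ 0) hE.time (hE.base_psi 0)

theorem exists_curl_eq_const (a b : Fin n) :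
    ∃ c, ∀ z ∈ pointSpace D, dirDeriv (baseDir b.succ) (baseComp Q a.succ) z -
      dirDeriv (baseDir a.succ) (baseComp Q b.succ) z = c := by
  have hU := hD.isOpen_pointSpace
  have hξ (a : Fin n) := contDiffOn_baseComp hQ a.succ
  have hderiv (a b : Fin n) {z} (hz : z ∈ pointSpace D) :=
    differentiableAt_of_contDiffOn hU (contDiffOn_dirDeriv hU (hξ a) (baseDir b.succ)) hz
  have hψ (a b : Fin n) := isPsiIndependent_dirDeriv (hE.base_psi a.succ) hU (hξ a) (baseDir b.succ)
  refine hD.exists_eq_const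
    (fun z hz => ((hderiv a b hz).fun_sub (hderiv b a hz)).differentiableWithinAt)
    (fun z hz μ => ?_) fun z hz w => ?_
  · rw [dirDeriv_sub _ (hderiv a b hz) (hderiv b a hz)]
    refine Fin.cases ?_ (fun c => ?_) μ
    · rw [hE.dirDeriv_time_dirDeriv_baseComp_symm hz hU hQ, sub_self]
    · rw [hE.dirDeriv_dirDeriv_baseComp_succ hz hU hQ, hE.dirDeriv_dirDeriv_baseComp_succ hz hU hQ,
        sub_self]
  · rw [dirDeriv_sub _ (hderiv a b hz) (hderiv b a hz), hψ a b z hz, hψ b a z hz, sub_self]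

theorem exists_skew_dirDeriv_baseComp_succ :
    ∃ κ : Matrix (Fin n) (Fin n) ℝ, κ.transpose = -κ ∧ ∀ z ∈ pointSpace D, ∀ a b,
      dirDeriv (baseDir b.succ) (baseComp Q a.succ) z =
        κ a b + if a = b then 1 / 2 * dirDeriv (baseDir 0) (baseComp Q 0) z else 0 := by
  choose c hc using hE.exists_curl_eq_const hD hQ
  obtain ⟨p, hp⟩ := hD.isConnected.nonempty
  refine ⟨Matrix.of fun a b => 1 / 2 * c a b, Matrix.ext fun a b => ?_, fun z hz a b => ?_⟩
  · have hp := hD.ofReal_mem_pointSpace hp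
    simp only [Matrix.transpose_apply, Matrix.neg_apply, Matrix.of_apply, ← hc _ _ _ hp]
    ring
  · have hkilling := hE.killing z hz a b
    rw [Matrix.of_apply, ← hc a b z hz]
    split_ifs at hkilling ⊢ <;> linear_combination hkilling / 2

theorem exists_baseComp_succ_eq_spaceComp_add (hτ : ContDiffOn ℝ ∞ τ (timeSet D))
    (htime : Set.EqOn (baseComp Q 0) (fun z => τ (z.1 0)) (pointSpace D))
    (hκ : ∀ z ∈ pointSpace D, ∀ a b, dirDeriv (baseDir b.succ) (baseComp Q a.succ) z =
      κ a b + if a = b then 1 / 2 * dirDeriv (baseDir 0) (baseComp Q 0) z else 0) (a : Fin n) :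
    ∃ φ : ℝ → ℝ, ContDiffOn ℝ ∞ φ (timeSet D) ∧
      ∀ z ∈ pointSpace D, baseComp Q a.succ z = spaceComp τ κ 0 a z + φ (z.1 0) := by
  have hT := hD.isOpen_timeSet
  have h0 (a : Fin n) : ContDiffOn ℝ ∞ ((0 : Fin n → ℝ → ℝ) a) (timeSet D) := contDiffOn_const
  have hξ := (contDiffOn_spaceComp hT hτ h0 (κ := κ) a).mono fun _ => mem_timeSet
  refine hD.exists_eq_add_comp_time (contDiffOn_baseComp hQ a.succ) hξ
    (fun z hz b => ?_) fun z hz w => ?_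
  · have hτ' := (dirDeriv_congr hD.isOpen_pointSpace htime (baseDir 0) hz).trans
      (dirDeriv_comp_time hT (mem_timeSet hz) _ hτ)
    rw [hκ z hz, hτ', dirDeriv_spaceComp hT (mem_timeSet hz) _ hτ h0, sum_mul_single_succ]
    simp [Pi.single_apply, add_comm]
  · rw [hE.base_psi _ z hz, dirDeriv_spaceComp hT (mem_timeSet hz) _ hτ h0]
    simp

theorem exists_psiCoeff_eq_psiFactor_add (hτ : ContDiffOn ℝ ∞ τ (timeSet D))
    (hχ : ∀ a, ContDiffOn ℝ ∞ (χ a) (timeSet D))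
    (hspace : ∀ a, Set.EqOn (baseComp Q a.succ) (spaceComp τ κ χ a) (pointSpace D)) :
    ∃ φ : ℝ → ℂ, ContDiffOn ℝ ∞ φ (timeSet D) ∧
      ∀ z ∈ pointSpace D, psiCoeff Q z = psiFactor τ χ 0 0 z + φ (z.1 0) := by
  have hU := hD.isOpen_pointSpace
  have hT := hD.isOpen_timeSet
  have h0 : ContDiffOn ℝ ∞ (0 : ℝ → ℝ) (timeSet D) := contDiffOn_const
  refine hD.exists_eq_add_comp_time (contDiffOn_psiCoeff hU hQ)
    ((contDiffOn_psiFactor hT hτ hχ h0 h0).mono fun _ => mem_timeSet) (fun z hz a => ?_)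
    fun z hz w => ?_
  · refine mul_left_cancel₀ two_ne_zero ?_
    rw [hE.phase z hz a, dirDeriv_congr hU (hspace a) (baseDir 0) hz,
      two_mul_dirDeriv_space_psiFactor hT (mem_timeSet hz) hτ hχ h0 h0]
  · rw [hE.isPsiIndependent_psiCoeff hU hQ z hz,
      dirDeriv_psiFactor hT (mem_timeSet hz) _ hτ hχ h0 h0,
      dirDeriv_phaseComp hT (mem_timeSet hz) _ hτ hχ h0]
    simp

theorem exists_psiCoeff_eq_psiFactor (hτ : ContDiffOn ℝ ∞ τ (timeSet D))
    (hχ : ∀ a, ContDiffOn ℝ ∞ (χ a) (timeSet D))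
    (hspace : ∀ a, Set.EqOn (baseComp Q a.succ) (spaceComp τ κ χ a) (pointSpace D)) :
    ∃ σ ζ : ℝ → ℝ, ContDiffOn ℝ ∞ σ (timeSet D) ∧ ContDiffOn ℝ ∞ ζ (timeSet D) ∧
      ∀ z ∈ pointSpace D, psiCoeff Q z = psiFactor τ χ σ ζ z := by
  obtain ⟨φ, hφ, hcoeff⟩ := hE.exists_psiCoeff_eq_psiFactor_add hD hQ hτ hχ hspace
  refine ⟨fun t => (φ t).im, fun t => (φ t).re, Complex.imCLM.contDiff.comp_contDiffOn hφ,
    Complex.reCLM.contDiff.comp_contDiffOn hφ, fun z hz => ?_⟩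
  rw [hcoeff z hz]
  simp only [psiFactor, phaseComp, Pi.zero_apply, Complex.ofReal_add, Complex.ofReal_zero]
  linear_combination -Complex.re_add_im (φ (z.1 0))

theorem exists_hasNormalForm (hinhom : ∀ z ∈ pointSpace D, inhomPart Q z = 0) :
    ∃ τ κ χ σ ζ, HasNormalForm D Q τ κ χ σ ζ := by
  obtain ⟨τ, hτ, htime⟩ := hE.exists_baseComp_zero_eqOn hD hQ
  obtain ⟨κ, hskew, hκ⟩ := hE.exists_skew_dirDeriv_baseComp_succ hD hQ
  choose χ hχ hshift using hE.exists_baseComp_succ_eq_spaceComp_add hD hQ hτ htime hκ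
  have hspace (a : Fin n) : Set.EqOn (baseComp Q a.succ) (spaceComp τ κ χ a) (pointSpace D) :=
    fun z hz => by
      rw [hshift a z hz, spaceComp, spaceComp, Pi.zero_apply, Pi.zero_apply, add_zero]
  obtain ⟨σ, ζ, hσ, hζ, hcoeff⟩ := hE.exists_psiCoeff_eq_psiFactor hD hQ hτ hχ hspace
  refine ⟨τ, κ, χ, σ, ζ, hτ, hχ, hσ, hζ, hskew, fun z hz => ?_⟩
  rw [generalField_eq hskew]
  refine Prod.ext (funext fun l => ?_) ?_
  · exact Fin.cases (htime hz) (fun a => hspace a hz) l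
  · rw [← hcoeff z hz]
    exact sub_eq_zero.1 (hinhom z hz)

end DeterminingEqs
end NLSym

end

theorem mainTheorem5 (n : ℕ) (hn : 1 ≤ n)
    (D : Set (NLSym.Base n × ℝ)) (hD : NLSym.IsAdmissibleDomain D)
    (S : NLSym.Base n × ℝ → ℂ) (hS : NLSym.IsClassS D S) (Q : NLSym.VField n) :
    Q ∈ NLSym.maximalLieInvarianceAlgebra D S ↔
      ∃ (τ : ℝ → ℝ) (κ : Matrix (Fin n) (Fin n) ℝ) (χ : Fin n → ℝ → ℝ) (σ ζ : ℝ → ℝ),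
        ContDiffOn ℝ ∞ τ (NLSym.timeSet D) ∧
        (∀ a, ContDiffOn ℝ ∞ (χ a) (NLSym.timeSet D)) ∧
        ContDiffOn ℝ ∞ σ (NLSym.timeSet D) ∧
        ContDiffOn ℝ ∞ ζ (NLSym.timeSet D) ∧
        κ.transpose = -κ ∧
        (∀ p ∈ D, NLSym.ClassifyingCondition S τ κ χ σ ζ p) ∧
        Set.EqOn Q (NLSym.generalField τ κ χ σ ζ) (NLSym.pointSpace D) := by
  rw [NLSym.mem_maximalLieInvarianceAlgebra_iff_zeroOrderLinear hn hD hS]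
  constructor
  · rintro ⟨⟨hQ, hE, hinhom⟩, hzero⟩
    obtain ⟨τ, κ, χ, σ, ζ, hN⟩ := hE.exists_hasNormalForm hD hQ hinhom
    refine ⟨τ, κ, χ, σ, ζ, hN.smooth_time, hN.smooth_shift, hN.smooth_phase, hN.smooth_scale,
      hN.skew, fun p hp => ?_, hN.eqOn⟩
    have hz := hD.ofReal_mem_pointSpace hp
    simpa only [hD.norm_ofReal hp] using (hN.zeroOrderLinear_eq_zero_iff hD hz).1 (hzero _ hz)
  · rintro ⟨τ, κ, χ, σ, ζ, hτ, hχ, hσ, hζ, hκ, hcond, hQ⟩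
    have hN : NLSym.HasNormalForm D Q τ κ χ σ ζ := ⟨hτ, hχ, hσ, hζ, hκ, hQ⟩
    exact ⟨⟨hN.contDiffOn hD, hN.determiningEqs hD, fun _ => hN.inhomPart_eq_zero hD⟩,
      fun z hz => (hN.zeroOrderLinear_eq_zero_iff hD hz).2 (hcond _ hz)⟩
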